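/- Let $n\ge 2$ and $d\ge 3$, and let $V(h)\subseteq\mathbb{P}^n=\mathbb{P}^n_{\mathbb{C}}$ be the degree $d$ hypersurface defined by the form $$h = z_0 z_1^{d-1} + z_1 z_2^{d-1} + (z_3^d + \cdots + z_n^d)\in\mathbb{C}[z_0,\dots,z_n].$$ For a hypersurface germ $\{f=0\}$ at the origin of $\mathbb{C}^n$, let $\mu^{(n)}=\dim_{\mathbb{C}}\mathbb{C}[[x_1,\dots,x_n]]/(\partial f/\partial x_1,\dots,\partial f/\partial x_n)$ be its Milnor number and let $\mu^{(i)}$, its $i$-th sectional Milnor number, be the Milnor number of its intersection with a general $i$-dimensional plane through the origin. Let $\deg(\mathrm{grad}(h))$ be the degree of the gradient map $\mathbb{P}^n\dashrightarrow\mathbb{P}^n$, $z\mapsto(\partial h/\partial z_0:\cdots:\partial h/\partial z_n)$, that is, the number of points in its fibre over a general point of $\mathbb{P}^n$. Then $V(h)$ has a unique singular point $x$; at $x$, in affine coordinates, $$\mu^{(n)} = (d-1)^n-(d-1)^{n-1}+(d-1)^{n-2}\quad\text{and}\quad \mu^{(n-1)}=(d-1)^{n-1}-(d-1)^{n-2};$$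 $V(h)$ is not a cone with the apex $x$; and $$\deg(\mathrm{grad}(h))=\mu^{(n-1)}.$$ Thus $V(h)$, a hypersurface with only isolated singular points that is not a cone with the apex $x$, attains equality in the inequality $\deg(\mathrm{grad}(h))\ge\mu^{(n-1)}$ at its point $x$. -/

import Mathlib

open scoped LinearAlgebra.Projectivization

namespace ProjHypersurface

noncomputable section

/-- Complex projective space `ℙⁿ`, with homogeneous coordinates `z₀, …, zₙ`. -/
abbrev PSpace (n : ℕ) : Type := ℙ ℂ (Fin (n + 1) → ℂ)

/-! ### Milnor numbers and sectional Milnor numbers of a germ at the origin -/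

/-- The ideal of `ℂ⟦x₁, …, xₙ⟧` generated by the partial derivatives of the polynomial `f`. -/
def jacobianIdeal {n : ℕ} (f : MvPolynomial (Fin n) ℂ) : Ideal (MvPowerSeries (Fin n) ℂ) :=
  Ideal.span (Set.range fun i : Fin n =>
    ((MvPolynomial.pderiv i f : MvPolynomial (Fin n) ℂ) : MvPowerSeries (Fin n) ℂ))

/-- The Milnor number at the origin of `f`: the dimension over `ℂ` of
`ℂ⟦x₁, …, xₙ⟧ / (∂f/∂x₁, …, ∂f/∂xₙ)`, equal to `⊤` if this dimension is infinite. -/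
def milnorNumber {n : ℕ} (f : MvPolynomial (Fin n) ℂ) : ℕ∞ :=
  Cardinal.toENat (Module.rank ℂ (MvPowerSeries (Fin n) ℂ ⧸ jacobianIdeal f))

/-- The restriction `y ↦ f (A y)` of `f` to the plane through the origin that is
parametrized by the `n × i` matrix `A`. -/
def restrictToPlane {n i : ℕ} (f : MvPolynomial (Fin n) ℂ) (A : Matrix (Fin n) (Fin i) ℂ) :
    MvPolynomial (Fin i) ℂ :=
  MvPolynomial.aeval
    (fun a : Fin n => ∑ b : Fin i, MvPolynomial.C (A a b) * MvPolynomial.X b) f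

/-- `k` is the `i`-th sectional Milnor number of `f` at the origin: the restriction of `f` to a
general `i`-dimensional plane through the origin has Milnor number `k` at the origin.
The planes are parametrized by the `n × i` matrices of rank `i`; a general plane is one
outside the zero set of a suitable nonzero polynomial `P` in the matrix entries. -/
def HasSectionalMilnorNumber {n : ℕ} (f : MvPolynomial (Fin n) ℂ) (i k : ℕ) : Prop :=
  ∃ P : MvPolynomial (Fin n × Fin i) ℂ, P ≠ 0 ∧
    ∀ A : Matrix (Fin n) (Fin i) ℂ, MvPolynomial.eval (fun ab => A ab.1 ab.2) P ≠ 0 →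
      A.rank = i ∧ milnorNumber (restrictToPlane f A) = k

/-! ### Projective hypersurfaces -/

/-- The point `p` lies on the hypersurface `V(h)`. -/
def MemV {n : ℕ} (h : MvPolynomial (Fin (n + 1)) ℂ) (p : PSpace n) : Prop :=
  MvPolynomial.eval p.rep h = 0

/-- The vector `(∂h/∂z₀, …, ∂h/∂zₙ)` at `v`. -/
def gradient {n : ℕ} (h : MvPolynomial (Fin (n + 1)) ℂ) (v : Fin (n + 1) → ℂ) :
    Fin (n + 1) → ℂ :=
  fun i => MvPolynomial.eval v (MvPolynomial.pderiv i h)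

/-- `p` is a singular point of `V(h)`. -/
def IsSingularPoint {n : ℕ} (h : MvPolynomial (Fin (n + 1)) ℂ) (p : PSpace n) : Prop :=
  MemV h p ∧ gradient h p.rep = 0

/-- The local equation of `V(h)` at `p` in the affine chart `z_j ≠ 0` (for `p` in this chart):
put `z_j = 1` and translate the affine coordinates so that `p` becomes the origin. -/
def localEquation {n : ℕ} (h : MvPolynomial (Fin (n + 1)) ℂ) (p : PSpace n) (j : Fin (n + 1)) :
    MvPolynomial (Fin n) ℂ :=
  MvPolynomial.aeval
    (j.insertNth (α := fun _ => MvPolynomial (Fin n) ℂ) 1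
      (fun a : Fin n => MvPolynomial.X a + MvPolynomial.C (p.rep (j.succAbove a) / p.rep j))) h

/-- `k` is the Milnor number of `V(h)` at `p`, computed in the standard affine charts around `p`. -/
def HasMilnorNumberAt {n : ℕ} (h : MvPolynomial (Fin (n + 1)) ℂ) (p : PSpace n) (k : ℕ) : Prop :=
  ∀ j : Fin (n + 1), p.rep j ≠ 0 → milnorNumber (localEquation h p j) = k

/-- `k` is the `i`-th sectional Milnor number of `V(h)` at `p`. -/
def HasSectionalMilnorNumberAt {n : ℕ} (h : MvPolynomial (Fin (n + 1)) ℂ) (p : PSpace n)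
    (i k : ℕ) : Prop :=
  ∀ j : Fin (n + 1), p.rep j ≠ 0 → HasSectionalMilnorNumber (localEquation h p j) i k

/-- `V(h)` is a cone with the apex `p`: it contains `p` and, with any point `w`, the line
through `p` and `w`. -/
def IsConeWithApex {n : ℕ} (h : MvPolynomial (Fin (n + 1)) ℂ) (p : PSpace n) : Prop :=
  MemV h p ∧ ∀ w : PSpace n, MemV h w →
    ∀ s t : ℂ, MvPolynomial.eval (s • p.rep + t • w.rep) h = 0

/-- The fibre over `q` of the gradient map `ℙⁿ ⇢ ℙⁿ` of `h`, which is defined at the points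
where the partial derivatives of `h` do not all vanish. -/
def gradientFibre {n : ℕ} (h : MvPolynomial (Fin (n + 1)) ℂ) (q : PSpace n) : Set (PSpace n) :=
  {p | ∃ hp : gradient h p.rep ≠ 0, Projectivization.mk ℂ (gradient h p.rep) hp = q}

/-- `k` is the polar degree of `h`, the degree of its gradient map: the fibre over a general
point of `ℙⁿ` (outside the zero set of a suitable nonzero form `P`) has exactly `k` points. -/
def HasPolarDegree {n : ℕ} (h : MvPolynomial (Fin (n + 1)) ℂ) (k : ℕ) : Prop :=
  ∃ (P : MvPolynomial (Fin (n + 1)) ℂ) (N : ℕ), P ≠ 0 ∧ P.IsHomogeneous N ∧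
    ∀ q : PSpace n, ¬ MemV P q → (gradientFibre h q).encard = k

/-- The form `z₀ z₁^(d-1) + z₁ z₂^(d-1) + z₃^d + ⋯ + zₙ^d`. -/
def exampleForm (n d : ℕ) (hn : 2 ≤ n) : MvPolynomial (Fin (n + 1)) ℂ :=
  MvPolynomial.X ⟨0, by omega⟩ * MvPolynomial.X ⟨1, by omega⟩ ^ (d - 1)
    + MvPolynomial.X ⟨1, by omega⟩ * MvPolynomial.X ⟨2, by omega⟩ ^ (d - 1)
    + ∑ i : Fin (n + 1) with 3 ≤ i.val, MvPolynomial.X i ^ d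

end

end ProjHypersurface

/-! Write `n = m + 2` and `d = k + 2`, so `k ≥ 1`. The gradient of the form is `(z₁^(k+1),
(k+1)z₀z₁^k + z₂^(k+1), (k+1)z₁z₂^k, (k+2)zᵢ^(k+1))`. Its zeros force every coordinate but `z₀` to
vanish, so `x = (1:0:⋯:0)`, and putting `z₀ = 1` gives the local equation `x₀^(k+1) + x₀x₁^(k+1) + ∑
zᵢ^(k+2)`.

Milnor number: modulo the partial derivatives, `x₀x₁^k = 0`, `zᵢ^(k+1) = 0` and `x₁^(k+1) =
-(k+1)x₀^k`, whence `x₀^(k+1) = x₁^(2k+1) = 0`. The surviving monomials in `x₀, x₁` are `x₀^a x₁^b`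
with `a ≤ k`, `b < k`, together with `x₁^k`. This gives `(k²+k+1)(k+1)^m`
(`toENat_rank_quotient_span_cuspPartials`).

Sectional number: after a linear change of parameters a general hyperplane is a graph `x₁ = L`. The
partial derivatives of the restriction are, up to unit constants, `x₀^k` and `zᵢ^(k+1)` plus terms
of higher weight for suitable weights. Such a system has colength the product of the exponents, here
`k(k+1)^m` (`toENat_rank_quotient_span_of_hasLeadingMonomial`).

Polar degree: over a point with no zero coordinate, normalize `z₁ = 1`. Then `z₂` is one of `k`
roots, each of the `m` coordinates `zᵢ` is one of `k+1` roots, and `z₀` is determined, so the fibre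
again has `k(k+1)^m` points. -/

section

open MvPowerSeries Finsupp

namespace MvPowerSeries

/-! ### Dimensions of quotients and monomial ideals in power series rings -/

section Quotient

variable {σ K : Type*} [Field K]

theorem toENat_rank_quotient_of_surjective {B : Type*} [Fintype B]
    (I : Ideal (MvPowerSeries σ K)) (φ : MvPowerSeries σ K →ₗ[K] (B → K))
    (hφ : Function.Surjective φ) (hker : ∀ f, φ f = 0 ↔ f ∈ I) :
    Cardinal.toENat (Module.rank K (MvPowerSeries σ K ⧸ I)) = Fintype.card B := by
  have hk : LinearMap.ker φ = I.restrictScalars K := by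
    ext f
    simp [LinearMap.mem_ker, hker]
  let e : (MvPowerSeries σ K ⧸ I) ≃ₗ[K] (B → K) :=
    (Submodule.Quotient.restrictScalarsEquiv K I).symm ≪≫ₗ
      (Submodule.quotEquivOfEq _ _ hk.symm) ≪≫ₗ φ.quotKerEquivOfSurjective hφ
  have := Module.Finite.equiv e.symm
  rw [← Module.finrank_eq_rank, e.finrank_eq, Module.finrank_fintype_fun_eq_card]
  simp

/-- The coefficients at the exponents in `B`. -/
noncomputable def coeffs (B : Finset (σ →₀ ℕ)) : MvPowerSeries σ K →ₗ[K] (B → K) :=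
  LinearMap.pi fun β => coeff (β : σ →₀ ℕ)

theorem coeffs_apply (B : Finset (σ →₀ ℕ)) (f : MvPowerSeries σ K) (β : B) :
    coeffs B f β = coeff (β : σ →₀ ℕ) f := rfl

theorem coeffs_surjective (B : Finset (σ →₀ ℕ)) :
    Function.Surjective (coeffs (K := K) B) := by
  classical
  intro v
  refine ⟨fun γ => if h : γ ∈ B then v ⟨γ, h⟩ else 0, ?_⟩
  ext β
  change (if h : (β : σ →₀ ℕ) ∈ B then v ⟨β, h⟩ else 0) = v β
  simp

/-- Each exponent in the support is assigned to one generator dividing it, and the terms assigned to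
the same generator are collected into its cofactor. Since there are finitely many generators, this
works for infinite series. -/
theorem mem_span_monomial_of_support {ι : Type*} [Finite ι] (s : ι → σ →₀ ℕ)
    (f : MvPowerSeries σ K) (h : ∀ β, coeff β f ≠ 0 → ∃ i, s i ≤ β) :
    f ∈ Ideal.span (Set.range fun i => monomial (s i) (1 : K)) := by
  classical
  have := Fintype.ofFinite ι
  choose c hc using h
  let g : ι → MvPowerSeries σ K := fun i γ =>
    if hγ : coeff (γ + s i) f ≠ 0 then (if c _ hγ = i then coeff (γ + s i) f else 0) else 0
  have hg : ∀ i β (_ : s i ≤ β) (hβ : coeff β f ≠ 0),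
      coeff (β - s i) (g i) = if c β hβ = i then coeff β f else 0 := by
    intro i β hi hβ
    have : coeff (β - s i) (g i) = if hγ : coeff (β - s i + s i) f ≠ 0 then
      (if c _ hγ = i then coeff (β - s i + s i) f else 0) else 0 := rfl
    simp_rw [this, tsub_add_cancel_of_le hi]
    rw [dif_pos hβ]
  have hg0 : ∀ i β (_ : s i ≤ β) (_ : coeff β f = 0), coeff (β - s i) (g i) = 0 := by
    intro i β hi hβ
    have : coeff (β - s i) (g i) = if hγ : coeff (β - s i + s i) f ≠ 0 then
      (if c _ hγ = i then coeff (β - s i + s i) f else 0) else 0 := rfl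
    rw [this, dif_neg]
    rwa [tsub_add_cancel_of_le hi, not_not]
  have hf : f = ∑ i, g i * monomial (s i) (1 : K) := by
    ext β
    rw [map_sum]
    simp only [coeff_mul_monomial, mul_one]
    by_cases hβ : coeff β f = 0
    · rw [hβ, Finset.sum_eq_zero]
      intro i _
      split_ifs with h1
      exacts [hg0 i β h1 hβ, rfl]
    · rw [Finset.sum_eq_single (c β hβ)]
      · rw [if_pos (hc β hβ), hg _ _ (hc β hβ) hβ, if_pos rfl]
      · intro i _ hi
        split_ifs with h1
        exacts [by rw [hg i β h1 hβ, if_neg (Ne.symm hi)], rfl]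
      · simp
  rw [hf]
  exact Ideal.sum_mem _ fun i _ => Ideal.mul_mem_left _ _ (Ideal.subset_span ⟨i, rfl⟩)

end Quotient

/-! ### Unipotent operators for the weight filtration -/

section Unipotent

variable {σ K : Type*} [Field K]

/-- The series with no terms of weight less than `N`. -/
def IsOfWeightGE (w : σ → ℕ) (N : ℕ) (f : MvPowerSeries σ K) : Prop :=
  ∀ γ, weight w γ < N → coeff γ f = 0

theorem eq_zero_of_isOfWeightGE {w : σ → ℕ} {f : MvPowerSeries σ K}
    (h : ∀ N, IsOfWeightGE w N f) : f = 0 := by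
  ext γ
  exact h (weight w γ + 1) γ (Nat.lt_succ_self _)

theorem IsOfWeightGE.mono {w : σ → ℕ} {M N : ℕ} {f : MvPowerSeries σ K}
    (h : IsOfWeightGE w N f) (hMN : M ≤ N) : IsOfWeightGE w M f :=
  fun γ hγ => h γ (hγ.trans_le hMN)

/-- `T` is the identity plus an operator that raises the filtration, and the power series ring is
separated and complete for that filtration. A kernel element lies in every filtration step, hence is
zero; a preimage is the limit of a fixed-point iteration. -/
theorem bijective_of_raises_weight (w : σ → ℕ)
    (T : MvPowerSeries σ K →ₗ[K] MvPowerSeries σ K)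
    (hT : ∀ N f, IsOfWeightGE w N f → IsOfWeightGE w (N + 1) (T f - f)) :
    Function.Bijective T := by
  constructor
  · rw [← LinearMap.ker_eq_bot, LinearMap.ker_eq_bot']
    intro f hf
    refine eq_zero_of_isOfWeightGE (w := w) fun N => ?_
    induction N with
    | zero => intro γ hγ; omega
    | succ N ih =>
      intro γ hγ
      simpa [hf] using hT N f ih γ hγ
  · intro g
    -- A preimage of `g` is a fixed point of `f ↦ g - (T f - f)`, and this map is contracting for
    -- the filtration.
    let a : ℕ → MvPowerSeries σ K := fun N => (fun f => g - (T f - f))^[N] 0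
    have ha : ∀ N, a (N + 1) = g - (T (a N) - a N) := fun N =>
      Function.iterate_succ_apply' (fun f => g - (T f - f)) N 0
    have hstep : ∀ N, IsOfWeightGE w N (a (N + 1) - a N) := by
      intro N
      induction N with
      | zero => intro γ hγ; omega
      | succ N ih =>
        have := hT N _ ih
        intro γ hγ
        have h1 := this γ hγ
        have h2 : a (N + 1 + 1) - a (N + 1) =
            -(T (a (N + 1) - a N) - (a (N + 1) - a N)) := by
          rw [ha (N + 1), ha N]
          simp only [map_sub]
          abel
        rw [h2, map_neg, h1, neg_zero]
    have hdiff : ∀ N M, N ≤ M → IsOfWeightGE w N (a M - a N) := by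
      intro N M hNM
      induction M, hNM using Nat.le_induction with
      | base => intro γ _; simp
      | succ M hM ih =>
        intro γ hγ
        have h1 := ih γ hγ
        have h2 := (hstep M).mono hM γ hγ
        rw [map_sub] at h1 h2 ⊢
        linear_combination h1 + h2
    -- The coefficient at `γ` no longer changes from the iterate of index `weight w γ + 1` on, so
    -- the limit can be read off there.
    let f : MvPowerSeries σ K := fun γ => coeff γ (a (weight w γ + 1))
    have hf : ∀ N, IsOfWeightGE w N (f - a N) := by
      intro N γ hγ
      have h1 := hdiff (weight w γ + 1) N hγ γ (Nat.lt_succ_self _)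
      rw [map_sub] at h1 ⊢
      change coeff γ (a (weight w γ + 1)) - coeff γ (a N) = 0
      linear_combination -h1
    refine ⟨f, ?_⟩
    rw [← sub_eq_zero]
    refine eq_zero_of_isOfWeightGE (w := w) fun N => ?_
    have h1 := hT N _ (hf N)
    have h2 := hf (N + 1)
    have h3 : T f - g = (T (f - a N) - (f - a N)) + (f - a (N + 1)) := by
      rw [ha N, map_sub]; abel
    rw [h3]
    intro γ hγ
    rw [map_add, h1 γ (by omega), h2 γ (by omega), add_zero]

end Unipotent

/-! ### Series with a leading monomial -/

section Leading

variable {σ K : Type*} [Field K]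

/-- The series `f` is the sum of the monomial `x ^ β` and of terms of higher weight. -/
def HasLeadingMonomial (w : σ → ℕ) (β : σ →₀ ℕ) (f : MvPowerSeries σ K) : Prop :=
  ∀ γ, weight w γ ≤ weight w β → coeff γ f = Finsupp.single β (1 : K) γ

theorem HasLeadingMonomial.coeff_eq_zero {w : σ → ℕ} {β : σ →₀ ℕ} {f : MvPowerSeries σ K}
    (h : HasLeadingMonomial w β f) {γ : σ →₀ ℕ} (hγ : weight w γ < weight w β) :
    coeff γ f = 0 := by
  rw [h γ hγ.le, Finsupp.single_eq_of_ne]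
  rintro rfl
  exact lt_irrefl _ hγ

theorem HasLeadingMonomial.one (w : σ → ℕ) :
    HasLeadingMonomial w 0 (1 : MvPowerSeries σ K) := by
  classical
  intro γ _
  rw [coeff_one, Finsupp.single_apply]
  simp [eq_comm]

theorem HasLeadingMonomial.monomial (w : σ → ℕ) (β : σ →₀ ℕ) :
    HasLeadingMonomial w β (monomial β (1 : K)) := by
  classical
  intro γ _
  rw [coeff_monomial, Finsupp.single_apply]
  simp [eq_comm]

theorem HasLeadingMonomial.mul {w : σ → ℕ} {β β' : σ →₀ ℕ} {f f' : MvPowerSeries σ K}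
    (h : HasLeadingMonomial w β f) (h' : HasLeadingMonomial w β' f') :
    HasLeadingMonomial w (β + β') (f * f') := by
  classical
  intro γ hγ
  rw [map_add] at hγ
  have key : ∀ p ∈ Finset.HasAntidiagonal.antidiagonal γ, coeff p.1 f * coeff p.2 f' =
      Finsupp.single β (1 : K) p.1 * Finsupp.single β' (1 : K) p.2 := by
    rintro ⟨p, q⟩ hpq
    rw [Finset.HasAntidiagonal.mem_antidiagonal] at hpq
    dsimp only at hpq ⊢
    have hw : weight w p + weight w q = weight w γ := by rw [← map_add, hpq]
    -- The weights of `p` and `q` sum to at most those of `β` and `β'`. So either one of them is too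
    -- small and both sides vanish, or both weights are equal to the leading ones.
    rcases lt_or_ge (weight w p) (weight w β) with hp | hp
    · rw [← h p hp.le, h.coeff_eq_zero hp]; simp
    · have hq : weight w q ≤ weight w β' := by omega
      rcases hq.lt_or_eq with hq' | hq'
      · rw [← h' q hq, h'.coeff_eq_zero hq']; simp
      · rw [h p (by omega), h' q hq]
  rw [coeff_mul, Finset.sum_congr rfl key]
  simp only [Finsupp.single_apply, mul_ite, mul_one, mul_zero, ← ite_and]
  by_cases hβ : β + β' = γ
  · rw [if_pos hβ, Finset.sum_eq_single (β, β')]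
    · simp
    · rintro ⟨p, q⟩ _ hne
      rw [if_neg]
      rintro ⟨rfl, rfl⟩
      exact hne rfl
    · simp [hβ]
  · rw [if_neg hβ, Finset.sum_eq_zero]
    rintro ⟨p, q⟩ hpq
    rw [if_neg]
    rintro ⟨rfl, rfl⟩
    exact hβ (Finset.HasAntidiagonal.mem_antidiagonal.1 hpq)

theorem HasLeadingMonomial.pow {w : σ → ℕ} {β : σ →₀ ℕ} {f : MvPowerSeries σ K}
    (h : HasLeadingMonomial w β f) (n : ℕ) : HasLeadingMonomial w (n • β) (f ^ n) := by
  induction n with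
  | zero => simpa using HasLeadingMonomial.one w
  | succ n ih => rw [pow_succ, succ_nsmul]; exact ih.mul h

theorem HasLeadingMonomial.prod {ι : Type*} {w : σ → ℕ} (s : Finset ι) {β : ι → σ →₀ ℕ}
    {f : ι → MvPowerSeries σ K} (h : ∀ i ∈ s, HasLeadingMonomial w (β i) (f i)) :
    HasLeadingMonomial w (∑ i ∈ s, β i) (∏ i ∈ s, f i) := by
  classical
  induction s using Finset.induction_on with
  | empty => simpa using HasLeadingMonomial.one w
  | insert a s ha ih =>
    rw [Finset.sum_insert ha, Finset.prod_insert ha]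
    exact (h a (Finset.mem_insert_self a s)).mul
      (ih fun i hi => h i (Finset.mem_insert_of_mem hi))

end Leading

/-! ### Colength of a system with pure powers as leading monomials -/

section BaseExpansion

variable {σ K : Type*} [Fintype σ] [Field K]

/-- The monomial `x ^ β` with `x i ^ m i` replaced by `F i`. -/
noncomputable def replacePowers (m : σ → ℕ) (F : σ → MvPowerSeries σ K) (β : σ →₀ ℕ) :
    MvPowerSeries σ K :=
  ∏ i, (X i ^ (β i % m i) * F i ^ (β i / m i))

theorem hasLeadingMonomial_replacePowers {w m : σ → ℕ} {F : σ → MvPowerSeries σ K}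
    (hF : ∀ i, HasLeadingMonomial w (Finsupp.single i (m i)) (F i)) (β : σ →₀ ℕ) :
    HasLeadingMonomial w β (replacePowers m F β) := by
  classical
  have h : ∀ i ∈ Finset.univ, HasLeadingMonomial w
      (Finsupp.single i (β i % m i) + (β i / m i) • Finsupp.single i (m i))
      ((X i : MvPowerSeries σ K) ^ (β i % m i) * F i ^ (β i / m i)) := by
    intro i _
    rw [X_pow_eq]
    exact (HasLeadingMonomial.monomial w _).mul ((hF i).pow _)
  have h2 : ∑ i, (Finsupp.single i (β i % m i) + (β i / m i) • Finsupp.single i (m i)) = β := by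
    ext j
    rw [Finsupp.finsetSum_apply, Finset.sum_eq_single j]
    · simp [Nat.mod_add_div']
    · intro i _ hij
      simp [Finsupp.single_eq_of_ne (Ne.symm hij)]
    · simp
  have := HasLeadingMonomial.prod Finset.univ h
  rwa [h2] at this

/-- Adding `m i` to the `i`-th exponent keeps its remainder and raises its quotient by one, as for
digits in base `m i`. -/
theorem replacePowers_add_single {m : σ → ℕ} (hm : ∀ i, m i ≠ 0)
    (F : σ → MvPowerSeries σ K) (β : σ →₀ ℕ) (i : σ) :
    replacePowers m F (Finsupp.single i (m i) + β) = F i * replacePowers m F β := by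
  classical
  have h : F i = ∏ j, (if i = j then F j else 1) := by simp
  rw [replacePowers, replacePowers, h, ← Finset.prod_mul_distrib]
  refine Finset.prod_congr rfl fun j _ => ?_
  by_cases hij : i = j
  · subst hij
    simp only [Finsupp.add_apply, Finsupp.single_eq_same, if_true]
    rw [Nat.add_mod_left, Nat.add_div_left _ (Nat.pos_of_ne_zero (hm i)), pow_succ]
    ring
  · simp [hij]

theorem coeff_replacePowers_eq_zero {w m : σ → ℕ} {F : σ → MvPowerSeries σ K}
    (hF : ∀ i, HasLeadingMonomial w (Finsupp.single i (m i)) (F i)) {β γ : σ →₀ ℕ}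
    (h : weight w γ < weight w β) : coeff γ (replacePowers m F β) = 0 :=
  (hasLeadingMonomial_replacePowers hF β).coeff_eq_zero h

/-- The exponents of weight at most `N`. -/
noncomputable def exponentsLE (w : σ → ℕ) (hw : ∀ i, w i ≠ 0) (N : ℕ) : Finset (σ →₀ ℕ) :=
  (finite_of_nat_weight_le w hw N).toFinset

theorem mem_exponentsLE {w : σ → ℕ} {hw : ∀ i, w i ≠ 0} {N : ℕ} {β : σ →₀ ℕ} :
    β ∈ exponentsLE w hw N ↔ weight w β ≤ N := by
  simp [exponentsLE]

/-- The linear endomorphism that sends each monomial `x ^ β` to `replacePowers m F β`. -/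
noncomputable def baseExpansion (w : σ → ℕ) (hw : ∀ i, w i ≠ 0) (m : σ → ℕ)
    (F : σ → MvPowerSeries σ K) : MvPowerSeries σ K →ₗ[K] MvPowerSeries σ K where
  toFun f := fun γ =>
    -- Positive weights make this sum finite. When each `F i` has leading monomial `x i ^ m i`,
    -- exponents of larger weight contribute nothing at `γ`.
    ∑ β ∈ exponentsLE w hw (weight w γ), coeff β f * coeff γ (replacePowers m F β)
  map_add' f g := by
    ext γ
    simp only [map_add, add_mul, Finset.sum_add_distrib]
    rfl
  map_smul' c f := by
    ext γ
    simp only [map_smul, smul_eq_mul, RingHom.id_apply, mul_assoc, ← Finset.mul_sum]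
    rfl

theorem coeff_baseExpansion {w : σ → ℕ} (hw : ∀ i, w i ≠ 0) {m : σ → ℕ}
    {F : σ → MvPowerSeries σ K}
    (hF : ∀ i, HasLeadingMonomial w (Finsupp.single i (m i)) (F i))
    (f : MvPowerSeries σ K) (γ : σ →₀ ℕ) (N : ℕ) (hN : weight w γ ≤ N) :
    coeff γ (baseExpansion w hw m F f) =
      ∑ β ∈ exponentsLE w hw N, coeff β f * coeff γ (replacePowers m F β) := by
  change ∑ β ∈ exponentsLE w hw (weight w γ), _ = _
  refine Finset.sum_subset ?_ ?_
  · intro β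
    simp only [mem_exponentsLE]
    omega
  · intro β _ hβ
    rw [mem_exponentsLE, not_le] at hβ
    rw [coeff_replacePowers_eq_zero hF hβ, mul_zero]

theorem baseExpansion_bijective {w : σ → ℕ} (hw : ∀ i, w i ≠ 0) {m : σ → ℕ}
    {F : σ → MvPowerSeries σ K}
    (hF : ∀ i, HasLeadingMonomial w (Finsupp.single i (m i)) (F i)) :
    Function.Bijective (baseExpansion w hw m F) := by
  classical
  refine bijective_of_raises_weight w _ fun N f hf γ hγ => ?_
  rw [map_sub, coeff_baseExpansion hw hF f γ _ le_rfl, Finset.sum_eq_single γ]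
  · rw [hasLeadingMonomial_replacePowers hF γ γ le_rfl]
    simp
  · intro β hβ hne
    rw [mem_exponentsLE] at hβ
    rcases lt_or_ge (weight w β) N with h | h
    · rw [hf β h, zero_mul]
    · rw [hasLeadingMonomial_replacePowers hF β γ (by omega),
        Finsupp.single_eq_of_ne (Ne.symm hne), mul_zero]
  · simp [mem_exponentsLE]

/-- The operator turns multiplication by `x i ^ m i` into multiplication by `F i`, so it carries the
monomial ideal of these powers to the ideal of the `F i`. -/
theorem baseExpansion_monomial_mul {w : σ → ℕ} (hw : ∀ i, w i ≠ 0) {m : σ → ℕ}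
    (hm : ∀ i, m i ≠ 0) {F : σ → MvPowerSeries σ K}
    (hF : ∀ i, HasLeadingMonomial w (Finsupp.single i (m i)) (F i))
    (i : σ) (g : MvPowerSeries σ K) :
    baseExpansion w hw m F (monomial (Finsupp.single i (m i)) 1 * g) =
      F i * baseExpansion w hw m F g := by
  classical
  ext γ
  set s : σ →₀ ℕ := Finsupp.single i (m i) with hs
  have hR : coeff γ (F i * baseExpansion w hw m F g) =
      ∑ β ∈ exponentsLE w hw (weight w γ), coeff β g * coeff γ (replacePowers m F (s + β)) := by
    rw [coeff_mul]
    have : ∀ p ∈ Finset.HasAntidiagonal.antidiagonal γ, coeff p.1 (F i) * coeff p.2 (baseExpansion w hw m F g) =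
        ∑ β ∈ exponentsLE w hw (weight w γ),
          coeff β g * (coeff p.1 (F i) * coeff p.2 (replacePowers m F β)) := by
      intro p hp
      rw [Finset.HasAntidiagonal.mem_antidiagonal] at hp
      rw [coeff_baseExpansion hw hF g p.2 (weight w γ) (by rw [← hp, map_add]; omega),
        Finset.mul_sum]
      exact Finset.sum_congr rfl fun β _ => by ring
    rw [Finset.sum_congr rfl this, Finset.sum_comm]
    refine Finset.sum_congr rfl fun β _ => ?_
    rw [replacePowers_add_single hm, coeff_mul, Finset.mul_sum]
  -- The bound is enlarged by the weight of `s` so that the shift `β ↦ s + β` stays in range. The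
  -- exponents missed by the shift contribute zero.
  rw [hR, coeff_baseExpansion hw hF _ γ (weight w γ + weight w s) (by omega)]
  symm
  refine Finset.sum_of_injOn (fun β => s + β) (fun a _ b _ h => add_left_cancel h) ?_ ?_ ?_
  · intro β hβ
    simp only [Finset.mem_coe, mem_exponentsLE, map_add] at hβ ⊢
    omega
  · intro β hβ hn
    rw [coeff_monomial_mul]
    split_ifs with h
    · rcases le_or_gt (weight w (β - s)) (weight w γ) with h1 | h1
      · exact absurd ⟨β - s, by simpa [mem_exponentsLE] using h1, add_tsub_cancel_of_le h⟩ hn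
      · rw [coeff_replacePowers_eq_zero hF, mul_zero]
        rw [← add_tsub_cancel_of_le h, map_add]
        omega
    · rw [zero_mul]
  · intro β _
    rw [coeff_monomial_mul, if_pos (by simp), add_tsub_cancel_left, one_mul]

/-- If each `F i` is the sum of `x i ^ m i` and of terms of higher weight, then
`K⟦x⟧ / (F)` has dimension `∏ i, m i`. -/
theorem toENat_rank_quotient_span_of_hasLeadingMonomial (w : σ → ℕ) (hw : ∀ i, w i ≠ 0)
    (m : σ → ℕ) (hm : ∀ i, m i ≠ 0) (F : σ → MvPowerSeries σ K)
    (hF : ∀ i, HasLeadingMonomial w (Finsupp.single i (m i)) (F i)) :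
    Cardinal.toENat (Module.rank K (MvPowerSeries σ K ⧸ Ideal.span (Set.range F))) =
      (∏ i, m i : ℕ) := by
  classical
  -- Pulled back along `T`, the quotient becomes the one by the powers `x i ^ m i`, with the
  -- monomials in the box `B` as a basis.
  let T := LinearEquiv.ofBijective _ (baseExpansion_bijective hw hF)
  let B : Finset (σ →₀ ℕ) :=
    (Fintype.piFinset fun i => Finset.range (m i)).map
      Finsupp.equivFunOnFinite.symm.toEmbedding
  have hB : ∀ β, β ∈ B ↔ ∀ i, β i < m i := by
    intro β
    simp only [B, Finset.mem_map_equiv, Fintype.mem_piFinset, Equiv.symm_symm,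
      Finset.mem_range, Finsupp.equivFunOnFinite_apply]
  have hcard : Fintype.card B = ∏ i, m i := by
    simp [B]
  have hT : ∀ i g, T (monomial (Finsupp.single i (m i)) 1 * g) = F i * T g :=
    baseExpansion_monomial_mul hw hm hF
  rw [toENat_rank_quotient_of_surjective _ (coeffs B ∘ₗ T.symm.toLinearMap)
    ((coeffs_surjective B).comp T.symm.surjective), hcard]
  intro f
  obtain ⟨f, rfl⟩ := T.surjective f
  simp only [LinearMap.comp_apply, LinearEquiv.coe_coe, LinearEquiv.symm_apply_apply]
  constructor
  · intro h
    have h0 : f ∈ Ideal.span (Set.range fun i => monomial (Finsupp.single i (m i)) (1 : K)) := by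
      refine mem_span_monomial_of_support _ f fun β hβ => ?_
      by_contra! hcon
      refine hβ ?_
      have hβB : β ∈ B := (hB β).2 fun i => by
        by_contra! hi
        exact hcon i (by simpa using hi)
      exact congrFun h ⟨β, hβB⟩
    obtain ⟨c, rfl⟩ := Ideal.mem_span_range_iff_exists_fun.1 h0
    refine Ideal.mem_span_range_iff_exists_fun.2 ⟨fun i => T (c i), ?_⟩
    rw [map_sum]
    exact Finset.sum_congr rfl fun i _ => by rw [mul_comm (c i), hT, mul_comm]
  · intro h
    obtain ⟨c, hc⟩ := Ideal.mem_span_range_iff_exists_fun.1 h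
    have hf : f = ∑ i, monomial (Finsupp.single i (m i)) 1 * T.symm (c i) := by
      apply T.injective
      rw [← hc, map_sum]
      exact Finset.sum_congr rfl fun i _ => by rw [hT, T.apply_symm_apply, mul_comm]
    ext β
    rw [coeffs_apply, hf, map_sum, Pi.zero_apply]
    refine Finset.sum_eq_zero fun i _ => ?_
    rw [coeff_monomial_mul, if_neg]
    have := (hB β).1 β.2 i
    simpa using this

end BaseExpansion

end MvPowerSeries

namespace MvPowerSeries

theorem coeff_X_pow_mul_eq_ite {σ K : Type*} [Field K] (γ : σ →₀ ℕ) (i : σ) (n : ℕ)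
    (g : MvPowerSeries σ K) :
    coeff γ (X i ^ n * g) = if n ≤ γ i then coeff (γ - Finsupp.single i n) g else 0 := by
  rw [X_pow_eq, coeff_monomial_mul, one_mul]
  simp only [Finsupp.single_le_iff]

/-! ### The Milnor algebra of the local equation, by explicit normal forms -/

section CuspFamily

variable {K : Type*} [Field K] (m k : ℕ)

/-- The exponents of the monomials that form a basis modulo the partial derivatives of
`x₀ ^ (k + 1) + x₀ * x₁ ^ (k + 1) + ∑ i, xᵢ ^ (k + 2)`. -/
noncomputable def standardExponents : Finset (Fin (m + 2) →₀ ℕ) :=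
  ((insert (0, k) (Finset.range (k + 1) ×ˢ Finset.range k)) ×ˢ
    Fintype.piFinset fun _ : Fin m => Finset.range (k + 1)).image
    fun a => Finsupp.equivFunOnFinite.symm
      (Fin.cons a.1.1 (Fin.cons a.1.2 a.2 : Fin (m + 1) → ℕ) : Fin (m + 2) → ℕ)

theorem card_standardExponents :
    (standardExponents m k).card = (k ^ 2 + k + 1) * (k + 1) ^ m := by
  rw [standardExponents, Finset.card_image_of_injective, Finset.card_product,
    Finset.card_insert_of_notMem (by simp), Finset.card_product]
  · simp; ring
  · rintro ⟨⟨a, b⟩, c⟩ ⟨⟨a', b'⟩, c'⟩ h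
    have h := Finsupp.equivFunOnFinite.symm.injective h
    simp only [Fin.cons_inj] at h
    simp [h]

variable {m k} in
theorem mem_standardExponents {β : Fin (m + 2) →₀ ℕ} :
    β ∈ standardExponents m k ↔ (∀ i : Fin m, β i.succ.succ < k + 1) ∧
      ((β 0 < k + 1 ∧ β 1 < k) ∨ (β 0 = 0 ∧ β 1 = k)) := by
  simp only [standardExponents, Finset.mem_image, Finset.mem_product, Finset.mem_insert,
    Fintype.mem_piFinset, Finset.mem_range, Prod.exists, Prod.mk.injEq]
  constructor
  · rintro ⟨a, b, c, ⟨h1, h2⟩, rfl⟩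
    refine ⟨fun i => by simpa using h2 i, ?_⟩
    have : (1 : Fin (m + 2)) = Fin.succ 0 := rfl
    simp only [Finsupp.equivFunOnFinite_symm_apply_apply, Fin.cons_zero, this, Fin.cons_succ]
    tauto
  · rintro ⟨h1, h2⟩
    refine ⟨β 0, β 1, fun i => β i.succ.succ, ⟨by tauto, h1⟩, ?_⟩
    ext i
    refine Fin.cases ?_ (fun i => Fin.cases ?_ (fun i => ?_) i) i <;> simp

/-- The partial derivatives of `x₀ ^ (k + 1) + x₀ * x₁ ^ (k + 1) + ∑ i, xᵢ ^ (k + 2)`. -/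
noncomputable def cuspPartials : Fin (m + 2) → MvPowerSeries (Fin (m + 2)) K :=
  Fin.cons (C (k + 1 : K) * X 0 ^ k + X 1 ^ (k + 1))
    (Fin.cons (C (k + 1 : K) * (X 0 ^ 1 * X 1 ^ k))
      fun i : Fin m => C (k + 2 : K) * X i.succ.succ ^ (k + 1))

/-- The exponent of the monomial that is a multiple of `x ^ β` modulo `cuspPartials m k 0`. -/
noncomputable def shiftExponent (β : Fin (m + 2) →₀ ℕ) : Fin (m + 2) →₀ ℕ :=
  β + Finsupp.single 1 (k + 1) - Finsupp.single 0 k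

/-- The coefficients at `standardExponents m k` of the normal form modulo `cuspPartials m k`. -/
noncomputable def normalFormCoeffs :
    MvPowerSeries (Fin (m + 2)) K →ₗ[K] (standardExponents m k → K) :=
  LinearMap.pi fun β => coeff (β : Fin (m + 2) →₀ ℕ) -
    (if (β : Fin (m + 2) →₀ ℕ) 0 = k then (k + 1 : K) else 0) •
      coeff (shiftExponent m k β)

theorem normalFormCoeffs_apply (f : MvPowerSeries (Fin (m + 2)) K)
    (β : standardExponents m k) :
    normalFormCoeffs m k f β = coeff (β : Fin (m + 2) →₀ ℕ) f -
      (if (β : Fin (m + 2) →₀ ℕ) 0 = k then (k + 1 : K) else 0) *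
        coeff (shiftExponent m k β) f := rfl

variable {m k}

theorem shiftExponent_zero (β : Fin (m + 2) →₀ ℕ) : shiftExponent m k β 0 = β 0 - k := by
  simp [shiftExponent]

theorem shiftExponent_one (β : Fin (m + 2) →₀ ℕ) :
    shiftExponent m k β 1 = β 1 + (k + 1) := by
  simp [shiftExponent]

theorem shiftExponent_succ_succ (β : Fin (m + 2) →₀ ℕ) (i : Fin m) :
    shiftExponent m k β i.succ.succ = β i.succ.succ := by
  simp [shiftExponent, Fin.ext_iff]

theorem shiftExponent_sub_single (β : Fin (m + 2) →₀ ℕ) :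
    shiftExponent m k β - Finsupp.single 1 (k + 1) = β - Finsupp.single 0 k := by
  ext i
  simp only [shiftExponent, Finsupp.tsub_apply, Finsupp.add_apply]
  omega

/-- A shifted exponent has `x₁`-degree at least `k + 1`, so it is never standard. On series
supported on standard exponents the correction term vanishes. -/
theorem normalFormCoeffs_surjective :
    Function.Surjective (normalFormCoeffs (K := K) m k) := by
  classical
  intro v
  obtain ⟨f, hf⟩ : ∃ f : MvPowerSeries (Fin (m + 2)) K, ∀ γ, coeff γ f =
      if h : γ ∈ standardExponents m k then v ⟨γ, h⟩ else 0 := ⟨_, fun γ => rfl⟩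
  refine ⟨f, ?_⟩
  ext β
  rw [normalFormCoeffs_apply, hf, hf, dif_pos β.2, dif_neg, mul_zero, sub_zero]
  rw [mem_standardExponents, shiftExponent_one]
  omega

/-- For the first partial derivative, the contribution of `(k+1)x₀^k` at `β` cancels that of
`x₁^(k+1)` at the shifted exponent. The other partial derivatives contribute at neither exponent. -/
theorem normalFormCoeffs_mul_cuspPartials (hk : k ≠ 0) (i : Fin (m + 2))
    (g : MvPowerSeries (Fin (m + 2)) K) :
    normalFormCoeffs m k (cuspPartials m k i * g) = 0 := by
  ext β
  obtain ⟨β, hβ⟩ := β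
  rw [normalFormCoeffs_apply, Pi.zero_apply]
  dsimp only
  obtain ⟨h1, h2⟩ := mem_standardExponents.1 hβ
  refine Fin.cases ?_ (fun i => Fin.cases ?_ (fun i => ?_) i) i
  · simp only [cuspPartials, Fin.cons_zero, add_mul, mul_assoc, map_add, coeff_C_mul,
      coeff_X_pow_mul_eq_ite, shiftExponent_zero, shiftExponent_one, shiftExponent_sub_single]
    rw [if_neg (show ¬ k + 1 ≤ β 1 by omega), if_pos (show k + 1 ≤ β 1 + (k + 1) by omega),
      if_neg (show ¬ k ≤ β 0 - k by omega)]
    by_cases h : β 0 = k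
    · rw [if_pos h.ge, if_pos h]
      ring
    · rw [if_neg h, if_neg (by omega)]
      ring
  · simp only [cuspPartials, Fin.cons_zero, Fin.cons_succ, mul_assoc, coeff_C_mul,
      coeff_X_pow_mul_eq_ite, shiftExponent_zero, shiftExponent_one, Finsupp.tsub_apply]
    rw [if_neg (show ¬ 1 ≤ β 0 - k by omega)]
    split_ifs with h3 h4 <;> simp at * <;> omega
  · simp only [cuspPartials, Fin.cons_succ, mul_assoc, coeff_C_mul,
      coeff_X_pow_mul_eq_ite, shiftExponent_succ_succ]
    have h3 : ¬ k + 1 ≤ β i.succ.succ := by have := h1 i; omega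
    simp only [if_neg h3, mul_zero, sub_self]

/-- Subtracting a multiple of the first partial derivative removes the terms `x₁^(k+1), …, x₁^(2k)`
times monomials in the remaining variables. Vanishing normal form coefficients then leave only terms
in a monomial ideal contained in `J`. -/
theorem mem_span_cuspPartials_of_normalFormCoeffs_eq_zero [CharZero K] (hk : k ≠ 0)
    (f : MvPowerSeries (Fin (m + 2)) K) (hf : normalFormCoeffs m k f = 0) :
    f ∈ Ideal.span (Set.range (cuspPartials (K := K) m k)) := by
  classical
  set J := Ideal.span (Set.range (cuspPartials (K := K) m k)) with hJ
  have hunit : ∀ (c : K) (p : MvPowerSeries (Fin (m + 2)) K), c ≠ 0 → C c * p ∈ J → p ∈ J := by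
    intro c p hc h
    have : p = C c⁻¹ * (C c * p) := by
      rw [← mul_assoc, ← map_mul, inv_mul_cancel₀ hc, map_one, one_mul]
    rw [this]
    exact J.mul_mem_left _ h
  have hk1 : (k + 1 : K) ≠ 0 := by exact_mod_cast Nat.succ_ne_zero k
  have hk2 : (k + 2 : K) ≠ 0 := by exact_mod_cast Nat.succ_ne_zero (k + 1)
  have hF : C (k + 1 : K) * X 0 ^ k + X 1 ^ (k + 1) ∈ J := Ideal.subset_span ⟨0, rfl⟩
  have hG : (X 0 ^ 1 * X 1 ^ k : MvPowerSeries (Fin (m + 2)) K) ∈ J :=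
    hunit _ _ hk1 (Ideal.subset_span ⟨1, rfl⟩)
  have hP : ∀ i : Fin m, (X i.succ.succ ^ (k + 1) : MvPowerSeries (Fin (m + 2)) K) ∈ J :=
    fun i => hunit _ _ hk2 (Ideal.subset_span ⟨i.succ.succ, rfl⟩)
  have hx : (X 0 ^ (k + 1) : MvPowerSeries (Fin (m + 2)) K) ∈ J := by
    refine hunit _ _ hk1 ?_
    have : C (k + 1 : K) * X 0 ^ (k + 1) =
        X 0 * (C (k + 1 : K) * X 0 ^ k + X 1 ^ (k + 1)) -
          X 1 * (X 0 ^ 1 * X 1 ^ k : MvPowerSeries (Fin (m + 2)) K) := by ring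
    rw [this]
    exact J.sub_mem (J.mul_mem_left _ hF) (J.mul_mem_left _ hG)
  have hy : (X 1 ^ (2 * k + 1) : MvPowerSeries (Fin (m + 2)) K) ∈ J := by
    obtain ⟨l, rfl⟩ := Nat.exists_eq_succ_of_ne_zero hk
    have : (X 1 ^ (2 * (l + 1) + 1) : MvPowerSeries (Fin (m + 2)) K) =
        X 1 ^ (l + 1) * (C ((l + 1 : ℕ) + 1 : K) * X 0 ^ (l + 1) + X 1 ^ (l + 1 + 1)) -
          (C ((l + 1 : ℕ) + 1 : K) * X 0 ^ l) * (X 0 ^ 1 * X 1 ^ (l + 1)) := by ring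
    rw [this]
    exact J.sub_mem (J.mul_mem_left _ hF) (J.mul_mem_left _ hG)
  -- `p` is the quotient of the terms of `f` with `x₀`-degree `0` and `x₁`-degree from `k + 1` to
  -- `2k` by `x₁^(k+1)`, within the box in the other variables.
  obtain ⟨p, hp⟩ : ∃ p : MvPowerSeries (Fin (m + 2)) K, ∀ η, coeff η p =
      if η 0 = 0 ∧ η 1 < k ∧ ∀ i : Fin m, η i.succ.succ < k + 1 then
        coeff (η + Finsupp.single 1 (k + 1)) f else 0 := ⟨_, fun η => rfl⟩
  have hcond := fun β hβ => (normalFormCoeffs_apply m k f ⟨β, hβ⟩).symm.trans (congrFun hf _)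
  dsimp only [Pi.zero_apply] at hcond
  have hrest : f - (C (k + 1 : K) * X 0 ^ k + X 1 ^ (k + 1)) * p ∈
      Ideal.span (Set.range fun i => monomial ((Fin.cons (Finsupp.single 0 (k + 1))
        (Fin.cons (Finsupp.single 0 1 + Finsupp.single 1 k)
          (Fin.cons (Finsupp.single 1 (2 * k + 1))
            fun i : Fin m => Finsupp.single i.succ.succ (k + 1))) :
              Fin (m + 3) → Fin (m + 2) →₀ ℕ) i) (1 : K)) := by
    refine mem_span_monomial_of_support _ _ fun γ hγ => ?_
    by_contra! hcon
    refine hγ ?_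
    have c0 := hcon 0
    have c1 := hcon 1
    have c2 := hcon 2
    have c3 : ∀ i : Fin m, γ i.succ.succ < k + 1 := fun i => by
      have := hcon i.succ.succ.succ
      simp only [Fin.cons_succ, Finsupp.single_le_iff] at this
      omega
    have e1 : (1 : Fin (m + 3)) = Fin.succ 0 := rfl
    have e2 : (2 : Fin (m + 3)) = Fin.succ (Fin.succ 0) := rfl
    simp only [e1, e2, Fin.cons_zero, Fin.cons_succ, Finsupp.single_le_iff] at c0 c1 c2
    replace c1 : ¬ (1 ≤ γ 0 ∧ k ≤ γ 1) := by
      rintro ⟨h0, h1⟩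
      refine c1 fun i => ?_
      refine Fin.cases ?_ (fun i => Fin.cases ?_ (fun i => ?_) i) i <;>
        simp [Fin.ext_iff, h0, h1]
    simp only [add_mul, mul_assoc, map_add, map_sub, coeff_C_mul, coeff_X_pow_mul_eq_ite]
    by_cases hγB : γ ∈ standardExponents m k
    · have h2 := (mem_standardExponents.1 hγB).2
      have h3 := hcond γ hγB
      rw [if_neg (show ¬ k + 1 ≤ γ 1 by omega)]
      by_cases h : γ 0 = k
      · rw [if_pos h] at h3
        rw [if_pos h.ge, hp, if_pos]
        · have : γ - Finsupp.single 0 k + Finsupp.single 1 (k + 1) = shiftExponent m k γ := by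
            ext i
            simp only [shiftExponent, Finsupp.tsub_apply, Finsupp.add_apply,
              Finsupp.single_apply]
            split_ifs with h4 h5 <;> simp_all
          rw [this]
          linear_combination h3
        · refine ⟨by simp [h], ?_, ?_⟩
          · simp; omega
          · intro i
            have := c3 i
            simp [Fin.ext_iff]; omega
      · rw [if_neg h] at h3
        rw [if_neg (by omega)]
        linear_combination h3
    -- The remaining exponents are exactly those removed by `x₁^(k+1) * p`.
    · rw [mem_standardExponents] at hγB
      have hγ0 : γ 0 = 0 ∧ k + 1 ≤ γ 1 := by
        by_contra hn
        exact hγB ⟨c3, by omega⟩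
      rw [if_neg (by omega), if_pos hγ0.2, hp, if_pos]
      · rw [tsub_add_cancel_of_le (Finsupp.single_le_iff.2 hγ0.2)]
        ring
      · refine ⟨by simp [hγ0.1], ?_, ?_⟩
        · simp; omega
        · intro i
          have := c3 i
          simp [Fin.ext_iff]; omega
  have hle : Ideal.span (Set.range fun i => monomial ((Fin.cons (Finsupp.single 0 (k + 1))
        (Fin.cons (Finsupp.single 0 1 + Finsupp.single 1 k)
          (Fin.cons (Finsupp.single 1 (2 * k + 1))
            fun i : Fin m => Finsupp.single i.succ.succ (k + 1))) :
              Fin (m + 3) → Fin (m + 2) →₀ ℕ) i) (1 : K)) ≤ J := by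
    rw [Ideal.span_le]
    rintro _ ⟨i, rfl⟩
    refine Fin.cases ?_ (fun i => Fin.cases ?_ (fun i => Fin.cases ?_ (fun i => ?_) i) i) i
    · rw [X_pow_eq] at hx
      exact hx
    · rw [X_pow_eq, X_pow_eq, monomial_mul_monomial, one_mul] at hG
      exact hG
    · rw [X_pow_eq] at hy
      exact hy
    · have := hP i
      rw [X_pow_eq] at this
      exact this
  have := J.add_mem (hle hrest) (J.mul_mem_right p hF)
  rwa [sub_add_cancel] at this

theorem toENat_rank_quotient_span_cuspPartials [CharZero K] (hk : k ≠ 0) :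
    Cardinal.toENat (Module.rank K (MvPowerSeries (Fin (m + 2)) K ⧸
      Ideal.span (Set.range (cuspPartials (K := K) m k)))) =
      ((k ^ 2 + k + 1) * (k + 1) ^ m : ℕ) := by
  rw [toENat_rank_quotient_of_surjective _ (normalFormCoeffs m k)
    normalFormCoeffs_surjective, Fintype.card_coe, card_standardExponents]
  intro f
  refine ⟨mem_span_cuspPartials_of_normalFormCoeffs_eq_zero hk f, fun hf => ?_⟩
  obtain ⟨c, rfl⟩ := Ideal.mem_span_range_iff_exists_fun.1 hf
  rw [map_sum]
  refine Finset.sum_eq_zero fun i _ => ?_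
  rw [mul_comm, normalFormCoeffs_mul_cuspPartials hk]

end CuspFamily

end MvPowerSeries

namespace MvPowerSeries

/-! ### Weight estimates and rescaling of generators -/

section WeightGE

variable {σ K : Type*} [Field K] {w : σ → ℕ}

theorem IsOfWeightGE.mul {M N : ℕ} {f g : MvPowerSeries σ K}
    (hf : IsOfWeightGE w M f) (hg : IsOfWeightGE w N g) : IsOfWeightGE w (M + N) (f * g) := by
  classical
  intro γ hγ
  rw [coeff_mul]
  refine Finset.sum_eq_zero fun p hp => ?_
  rw [Finset.HasAntidiagonal.mem_antidiagonal] at hp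
  have hw : weight w p.1 + weight w p.2 = weight w γ := by rw [← map_add, hp]
  rcases lt_or_ge (weight w p.1) M with h | h
  · rw [hf _ h, zero_mul]
  · rw [hg _ (by omega), mul_zero]

theorem IsOfWeightGE.pow {N : ℕ} {f : MvPowerSeries σ K}
    (hf : IsOfWeightGE w N f) (n : ℕ) : IsOfWeightGE w (n * N) (f ^ n) := by
  induction n with
  | zero => intro γ hγ; simp at hγ
  | succ n ih => rw [pow_succ, Nat.succ_mul]; exact ih.mul hf

theorem IsOfWeightGE.add {N : ℕ} {f g : MvPowerSeries σ K}
    (hf : IsOfWeightGE w N f) (hg : IsOfWeightGE w N g) : IsOfWeightGE w N (f + g) := by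
  intro γ hγ
  rw [map_add, hf γ hγ, hg γ hγ, add_zero]

theorem IsOfWeightGE.C_mul {N : ℕ} {f : MvPowerSeries σ K} (c : K)
    (hf : IsOfWeightGE w N f) : IsOfWeightGE w N (C c * f) := by
  intro γ hγ
  rw [coeff_C_mul, hf γ hγ, mul_zero]

theorem IsOfWeightGE.sum {ι : Type*} {N : ℕ} (s : Finset ι) {f : ι → MvPowerSeries σ K}
    (hf : ∀ i ∈ s, IsOfWeightGE w N (f i)) : IsOfWeightGE w N (∑ i ∈ s, f i) := by
  intro γ hγ
  rw [map_sum]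
  exact Finset.sum_eq_zero fun i hi => hf i hi γ hγ

theorem isOfWeightGE_X (i : σ) : IsOfWeightGE w (w i) (X i : MvPowerSeries σ K) := by
  classical
  intro γ hγ
  rw [coeff_X, if_neg]
  rintro rfl
  simp [weight_single] at hγ

theorem HasLeadingMonomial.add_of_isOfWeightGE {β : σ →₀ ℕ} {f g : MvPowerSeries σ K}
    (hf : HasLeadingMonomial w β f) (hg : IsOfWeightGE w (weight w β + 1) g) :
    HasLeadingMonomial w β (f + g) := by
  intro γ hγ
  rw [map_add, hf γ hγ, hg γ (by omega), add_zero]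

theorem span_range_C_mul {ι : Type*} (c : ι → K) (hc : ∀ i, c i ≠ 0)
    (F : ι → MvPowerSeries σ K) :
    Ideal.span (Set.range fun i => C (c i) * F i) = Ideal.span (Set.range F) := by
  apply le_antisymm <;> rw [Ideal.span_le] <;> rintro _ ⟨i, rfl⟩
  · exact Ideal.mul_mem_left _ _ (Ideal.subset_span ⟨i, rfl⟩)
  · have : F i = C (c i)⁻¹ * (C (c i) * F i) := by
      rw [← mul_assoc, ← map_mul, inv_mul_cancel₀ (hc i), map_one, one_mul]
    rw [SetLike.mem_coe, this]
    exact Ideal.mul_mem_left _ _ (Ideal.subset_span ⟨i, rfl⟩)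

end WeightGE

end MvPowerSeries

namespace ProjHypersurface

/-! ### Linear substitutions and invariance of the Milnor number -/

section LinearSubstitution

variable {l n i : ℕ}

theorem restrictToPlane_restrictToPlane (f : MvPolynomial (Fin n) ℂ)
    (A : Matrix (Fin n) (Fin i) ℂ) (B : Matrix (Fin i) (Fin l) ℂ) :
    restrictToPlane (restrictToPlane f A) B = restrictToPlane f (A * B) := by
  unfold restrictToPlane
  rw [← AlgHom.comp_apply]
  congr 1
  ext1 a
  simp only [AlgHom.comp_apply, MvPolynomial.aeval_X, map_sum, map_mul,
    MvPolynomial.aeval_C, MvPolynomial.algebraMap_eq, Matrix.mul_apply, Finset.sum_mul,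
    Finset.mul_sum]
  rw [Finset.sum_comm]
  exact Finset.sum_congr rfl fun _ _ => Finset.sum_congr rfl fun _ _ => by ring

theorem restrictToPlane_one (f : MvPolynomial (Fin n) ℂ) :
    restrictToPlane f (1 : Matrix (Fin n) (Fin n) ℂ) = f := by
  unfold restrictToPlane
  conv_rhs => rw [← MvPolynomial.aeval_X_left_apply f]
  congr 2
  funext a
  simp [Matrix.one_apply]

/-- The chain rule for a linear map. -/
theorem pderiv_restrictToPlane (f : MvPolynomial (Fin n) ℂ) (A : Matrix (Fin n) (Fin i) ℂ)
    (j : Fin i) :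
    MvPolynomial.pderiv j (restrictToPlane f A) =
      ∑ a, MvPolynomial.C (A a j) * restrictToPlane (MvPolynomial.pderiv a f) A := by
  induction f using MvPolynomial.induction_on with
  | C c => simp [restrictToPlane]
  | add p q hp hq =>
    simp only [restrictToPlane, map_add, mul_add, Finset.sum_add_distrib] at hp hq ⊢
    rw [hp, hq]
  | mul_X p b hp =>
    simp only [restrictToPlane, map_mul, MvPolynomial.aeval_X, MvPolynomial.pderiv_mul,
      map_add] at hp ⊢
    rw [hp]
    have h1 : MvPolynomial.pderiv j (∑ c, MvPolynomial.C (A b c) * MvPolynomial.X c) =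
        MvPolynomial.C (A b j) := by
      rw [map_sum, Finset.sum_eq_single j]
      · rw [MvPolynomial.pderiv_C_mul, MvPolynomial.pderiv_X_self, mul_one]
      · intro c _ hc
        rw [MvPolynomial.pderiv_C_mul, MvPolynomial.pderiv_X_of_ne hc, mul_zero]
      · simp
    rw [h1]
    simp only [mul_add, Finset.sum_add_distrib, Finset.sum_mul, ← mul_assoc]
    congr 1
    rw [Finset.sum_eq_single b]
    · rw [MvPolynomial.pderiv_X_self, map_one]
      ring
    · intro a _ ha
      rw [MvPolynomial.pderiv_X_of_ne (Ne.symm ha), map_zero, mul_zero]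
    · simp

/-- The linear forms that are the rows of `A`, as power series. -/
noncomputable def rowForms (A : Matrix (Fin n) (Fin i) ℂ) (a : Fin n) :
    MvPowerSeries (Fin i) ℂ :=
  ((∑ b : Fin i, MvPolynomial.C (A a b) * MvPolynomial.X b : MvPolynomial (Fin i) ℂ) :
    MvPowerSeries (Fin i) ℂ)

theorem rowForms_eq_sum (A : Matrix (Fin n) (Fin i) ℂ) (a : Fin n) :
    rowForms A a = ∑ b, C (A a b) * X b := by
  rw [rowForms, ← MvPolynomial.coeToMvPowerSeries.ringHom_apply, map_sum]
  simp

theorem hasSubst_rowForms (A : Matrix (Fin n) (Fin i) ℂ) : HasSubst (rowForms A) := by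
  refine hasSubst_of_constantCoeff_zero fun a => ?_
  rw [rowForms_eq_sum, map_sum]
  simp

theorem subst_rowForms_coe (A : Matrix (Fin n) (Fin i) ℂ) (f : MvPolynomial (Fin n) ℂ) :
    substAlgHom (R := ℂ) (hasSubst_rowForms A) (f : MvPowerSeries (Fin n) ℂ) =
      (restrictToPlane f A : MvPolynomial (Fin i) ℂ) := by
  rw [substAlgHom_coe, restrictToPlane]
  have h : MvPolynomial.aeval (R := ℂ) (rowForms A) =
      (MvPolynomial.coeToMvPowerSeries.algHom ℂ).comp (MvPolynomial.aeval
        (fun a : Fin n => ∑ b : Fin i, MvPolynomial.C (A a b) * MvPolynomial.X b)) := by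
    ext1 a
    rw [MvPolynomial.aeval_X, AlgHom.comp_apply, MvPolynomial.aeval_X,
      MvPolynomial.coeToMvPowerSeries.algHom_apply, Algebra.algebraMap_self, map_id,
      RingHom.id_apply, rowForms]
  rw [h]
  simp

/-- A composition of substitutions is determined by the images of the variables; these are
polynomials, where composing restrictions is matrix multiplication. -/
theorem subst_rowForms_comp {A B : Matrix (Fin n) (Fin n) ℂ} (h : A * B = 1) :
    (substAlgHom (R := ℂ) (hasSubst_rowForms B)).comp
      (substAlgHom (R := ℂ) (hasSubst_rowForms A)) = AlgHom.id ℂ _ := by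
  ext1 f
  rw [AlgHom.comp_apply, AlgHom.id_apply, substAlgHom_apply, substAlgHom_apply,
    subst_comp_subst_apply (hasSubst_rowForms A) (hasSubst_rowForms B)]
  have : (fun s => subst (rowForms B) (rowForms A s)) =
      (MvPowerSeries.X : Fin n → MvPowerSeries (Fin n) ℂ) := by
    funext s
    have h1 : (rowForms A s) = ((restrictToPlane (MvPolynomial.X s) A : MvPolynomial (Fin n) ℂ) :
        MvPowerSeries (Fin n) ℂ) := by simp [rowForms, restrictToPlane]
    rw [h1, ← substAlgHom_apply (R := ℂ) (hasSubst_rowForms B), subst_rowForms_coe,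
      restrictToPlane_restrictToPlane, h, restrictToPlane_one, MvPolynomial.coe_X]
  rw [this, subst_self, id]

/-- The Milnor number is invariant under linear changes of coordinates. -/
theorem milnorNumber_restrictToPlane_of_mul_eq_one (f : MvPolynomial (Fin n) ℂ)
    {A B : Matrix (Fin n) (Fin n) ℂ} (h : A * B = 1) :
    milnorNumber (restrictToPlane f A) = milnorNumber f := by
  have h' : B * A = 1 := mul_eq_one_comm.1 h
  let e : MvPowerSeries (Fin n) ℂ ≃ₐ[ℂ] MvPowerSeries (Fin n) ℂ :=
    AlgEquiv.ofAlgHom _ _ (subst_rowForms_comp h') (subst_rowForms_comp h)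
  have he : ∀ p : MvPolynomial (Fin n) ℂ, e (p : MvPowerSeries (Fin n) ℂ) =
    (restrictToPlane p A : MvPolynomial (Fin n) ℂ) := subst_rowForms_coe A
  have hd : ∀ j, ((MvPolynomial.pderiv j (restrictToPlane f A) : MvPolynomial (Fin n) ℂ) :
      MvPowerSeries (Fin n) ℂ) = ∑ a, C (A a j) *
        e ((MvPolynomial.pderiv a f : MvPolynomial (Fin n) ℂ) : MvPowerSeries (Fin n) ℂ) := by
    intro j
    rw [pderiv_restrictToPlane, ← MvPolynomial.coeToMvPowerSeries.ringHom_apply, map_sum]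
    simp only [map_mul, MvPolynomial.coeToMvPowerSeries.ringHom_apply, MvPolynomial.coe_C, he]
  have hJ : jacobianIdeal (restrictToPlane f A) = (jacobianIdeal f).map (e : _ →+* _) := by
    rw [jacobianIdeal, jacobianIdeal, Ideal.map_span]
    apply le_antisymm <;> rw [Ideal.span_le]
    · rintro _ ⟨j, rfl⟩
      dsimp only
      rw [SetLike.mem_coe, hd]
      exact Ideal.sum_mem _ fun a _ => Ideal.mul_mem_left _ _
        (Ideal.subset_span ⟨_, ⟨a, rfl⟩, rfl⟩)
    · rintro _ ⟨_, ⟨a, rfl⟩, rfl⟩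
      -- Inverting the chain rule with `B` recovers the transformed partial derivatives from the new
      -- ones.
      have : e ((MvPolynomial.pderiv a f : MvPolynomial (Fin n) ℂ) : MvPowerSeries (Fin n) ℂ) =
          ∑ j, C (B j a) * ((MvPolynomial.pderiv j (restrictToPlane f A) :
            MvPolynomial (Fin n) ℂ) : MvPowerSeries (Fin n) ℂ) := by
        simp only [hd, Finset.mul_sum, ← mul_assoc, ← map_mul]
        rw [Finset.sum_comm]
        simp only [← Finset.sum_mul, ← map_sum]
        have hAB : ∀ x, ∑ j, B j a * A x j = if x = a then 1 else 0 := fun x => by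
          rw [← Matrix.one_apply, ← h, Matrix.mul_apply]
          exact Finset.sum_congr rfl fun _ _ => mul_comm _ _
        simp [hAB]
      rw [SetLike.mem_coe]
      change e _ ∈ _
      rw [this]
      exact Ideal.sum_mem _ fun j _ => Ideal.mul_mem_left _ _ (Ideal.subset_span ⟨j, rfl⟩)
  rw [milnorNumber, milnorNumber,
    (Ideal.quotientEquivAlg (jacobianIdeal f) _ e hJ).toLinearEquiv.rank_eq]

end LinearSubstitution

/-! ### The local equation at the singular point -/

section LocalForm

open MvPolynomial (pderiv)

/-- The affine equation `x₀ ^ (k + 1) + x₀ * x₁ ^ (k + 1) + ∑ i, xᵢ ^ (k + 2)`. -/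
noncomputable def localForm (m k : ℕ) : MvPolynomial (Fin (m + 2)) ℂ :=
  MvPolynomial.X 0 ^ (k + 1) + MvPolynomial.X 0 * MvPolynomial.X 1 ^ (k + 1) +
    ∑ i : Fin m, MvPolynomial.X i.succ.succ ^ (k + 2)

variable {m k : ℕ}

theorem pderiv_X_pow_succ {σ : Type*} [DecidableEq σ] (i j : σ) (n : ℕ) :
    pderiv i (MvPolynomial.X j ^ (n + 1) : MvPolynomial σ ℂ) =
      if i = j then MvPolynomial.C (n + 1 : ℂ) * MvPolynomial.X j ^ n else 0 := by
  rw [MvPolynomial.pderiv_pow]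
  split_ifs with h
  · subst h
    rw [MvPolynomial.pderiv_X_self]
    simp
  · rw [MvPolynomial.pderiv_X_of_ne (Ne.symm h), mul_zero]

theorem coe_pderiv_localForm (i : Fin (m + 2)) :
    ((pderiv i (localForm m k) : MvPolynomial (Fin (m + 2)) ℂ) :
      MvPowerSeries (Fin (m + 2)) ℂ) = cuspPartials m k i := by
  have h0 : ∀ i : Fin m, (0 : Fin (m + 2)) ≠ i.succ.succ := fun i => (Fin.succ_ne_zero _).symm
  have h1 : ∀ i : Fin m, (1 : Fin (m + 2)) ≠ i.succ.succ := fun i => by simp [Fin.ext_iff]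
  have hX0 : ∀ j : Fin (m + 2), j ≠ 0 →
      pderiv j (MvPolynomial.X 0 : MvPolynomial (Fin (m + 2)) ℂ) = 0 :=
    fun j hj => MvPolynomial.pderiv_X_of_ne hj.symm
  simp only [localForm, map_add, map_sum, MvPolynomial.pderiv_mul]
  simp only [pderiv_X_pow_succ]
  refine Fin.cases ?_ (fun i => Fin.cases ?_ (fun i => ?_) i) i
  · simp only [cuspPartials, h0, MvPolynomial.pderiv_X_self, if_true, zero_ne_one, if_false,
      Finset.sum_const_zero, one_mul, mul_zero, add_zero, Fin.cons_zero, MvPolynomial.coe_add,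
      MvPolynomial.coe_mul, MvPolynomial.coe_C, MvPolynomial.coe_pow, MvPolynomial.coe_X]
  · rw [Fin.succ_zero_eq_one, hX0 _ one_ne_zero]
    simp only [h1, if_true, one_ne_zero, if_false,
      Finset.sum_const_zero, zero_mul, zero_add, add_zero,
      MvPolynomial.coe_mul, MvPolynomial.coe_C, MvPolynomial.coe_pow, MvPolynomial.coe_X]
    change _ = C (k + 1 : ℂ) * (X 0 ^ 1 * X 1 ^ k)
    ring
  · rw [hX0 _ (h0 i).symm, if_neg (h0 i).symm, if_neg (h1 i).symm]
    simp only [cuspPartials, Fin.succ_inj, zero_mul, mul_zero, zero_add, Finset.sum_ite_eq,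
      Finset.mem_univ, if_true, Fin.cons_succ,
      MvPolynomial.coe_mul, MvPolynomial.coe_C, MvPolynomial.coe_pow, MvPolynomial.coe_X]
    congr 2
    push_cast
    ring

theorem milnorNumber_localForm (hk : k ≠ 0) :
    milnorNumber (localForm m k) = ((k ^ 2 + k + 1) * (k + 1) ^ m : ℕ) := by
  have hJ : jacobianIdeal (localForm m k) = Ideal.span (Set.range (cuspPartials m k)) := by
    rw [jacobianIdeal, ← funext coe_pderiv_localForm]
  rw [milnorNumber, hJ]
  exact toENat_rank_quotient_span_cuspPartials hk

end LocalForm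

end ProjHypersurface

namespace ProjHypersurface

/-! ### General hyperplane sections of the local equation -/

section SectionForm

open MvPolynomial (pderiv)

variable {m k : ℕ}

/-- The linear form `∑ b, a b * x_b`. -/
noncomputable def linearForm (a : Fin (m + 1) → ℂ) : MvPolynomial (Fin (m + 1)) ℂ :=
  ∑ b, MvPolynomial.C (a b) * MvPolynomial.X b

/-- The restriction of `localForm m k` to the hyperplane `x₁ = ∑ b, a b * x_b`. -/
noncomputable def sectionForm (k : ℕ) (a : Fin (m + 1) → ℂ) : MvPolynomial (Fin (m + 1)) ℂ :=
  MvPolynomial.X 0 ^ (k + 1) + MvPolynomial.X 0 * linearForm a ^ (k + 1) +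
    ∑ i : Fin m, MvPolynomial.X i.succ ^ (k + 2)

theorem pderiv_linearForm (a : Fin (m + 1) → ℂ) (j : Fin (m + 1)) :
    pderiv j (linearForm a) = MvPolynomial.C (a j) := by
  rw [linearForm, map_sum, Finset.sum_eq_single j]
  · rw [MvPolynomial.pderiv_C_mul, MvPolynomial.pderiv_X_self, mul_one]
  · intro c _ hc
    rw [MvPolynomial.pderiv_C_mul, MvPolynomial.pderiv_X_of_ne hc, mul_zero]
  · simp

theorem isOfWeightGE_linearForm (a : Fin (m + 1) → ℂ) {w : Fin (m + 1) → ℕ} {N : ℕ}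
    (hw : ∀ i, N ≤ w i) :
    IsOfWeightGE w N (linearForm a : MvPowerSeries (Fin (m + 1)) ℂ) := by
  rw [linearForm, ← MvPolynomial.coeToMvPowerSeries.ringHom_apply, map_sum]
  refine IsOfWeightGE.sum _ fun b _ => ?_
  rw [map_mul, MvPolynomial.coeToMvPowerSeries.ringHom_apply,
    MvPolynomial.coeToMvPowerSeries.ringHom_apply, MvPolynomial.coe_C, MvPolynomial.coe_X]
  exact ((isOfWeightGE_X b).mono (hw b)).C_mul _

theorem pderiv_sectionForm_zero (a : Fin (m + 1) → ℂ) :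
    pderiv 0 (sectionForm k a) = MvPolynomial.C (k + 1 : ℂ) * MvPolynomial.X 0 ^ k +
      (linearForm a ^ (k + 1) + MvPolynomial.C ((k + 1) * a 0) *
        (MvPolynomial.X 0 * linearForm a ^ k)) := by
  simp only [sectionForm, map_add, map_sum, MvPolynomial.pderiv_mul]
  rw [MvPolynomial.pderiv_pow (f := linearForm a), pderiv_linearForm]
  simp only [pderiv_X_pow_succ, (Fin.succ_ne_zero _).symm, MvPolynomial.pderiv_X_self,
    if_true, if_false, Finset.sum_const_zero]
  simp
  ring

theorem pderiv_sectionForm_succ (a : Fin (m + 1) → ℂ) (i : Fin m) :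
    pderiv i.succ (sectionForm k a) =
      MvPolynomial.C (k + 2 : ℂ) * MvPolynomial.X i.succ ^ (k + 1) +
        MvPolynomial.C ((k + 1) * a i.succ) * (MvPolynomial.X 0 * linearForm a ^ k) := by
  simp only [sectionForm, map_add, map_sum, MvPolynomial.pderiv_mul]
  rw [MvPolynomial.pderiv_pow (f := linearForm a), pderiv_linearForm,
    MvPolynomial.pderiv_X_of_ne (Fin.succ_ne_zero _).symm]
  simp only [pderiv_X_pow_succ, Fin.succ_ne_zero, Fin.succ_inj, if_false, Finset.sum_ite_eq,
    Finset.mem_univ, if_true]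
  have h2 : (MvPolynomial.C 2 : MvPolynomial (Fin (m + 1)) ℂ) = 2 := map_ofNat _ 2
  simp [h2]
  ring

/-- No condition on `a` is needed: the terms involving the linear form always have higher weight
than the pure powers. -/
theorem milnorNumber_sectionForm (hk : k ≠ 0) (a : Fin (m + 1) → ℂ) :
    milnorNumber (sectionForm k a) = (k * (k + 1) ^ m : ℕ) := by
  have hk1 : (k + 1 : ℂ) ≠ 0 := by exact_mod_cast Nat.succ_ne_zero k
  have hk2 : (k + 2 : ℂ) ≠ 0 := by exact_mod_cast Nat.succ_ne_zero (k + 1)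
  set L : MvPowerSeries (Fin (m + 1)) ℂ :=
    ((linearForm a : MvPolynomial (Fin (m + 1)) ℂ) : MvPowerSeries (Fin (m + 1)) ℂ) with hL
  -- With weights `k+2` for `x₀` and `k+1` for the others, `x₀^k` has weight `k²+2k` and each
  -- `zᵢ^(k+1)` has `k²+2k+1`. The remainders `L^(k+1)` and `x₀L^k` start at `k²+2k+1` and
  -- `k²+2k+2`; the former occurs only beside `x₀^k`.
  let w : Fin (m + 1) → ℕ := Fin.cons (k + 2) fun _ => k + 1
  let p : Fin (m + 1) → ℕ := Fin.cons k fun _ => k + 1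
  let c : Fin (m + 1) → ℂ := Fin.cons (k + 1) fun _ => k + 2
  let r : Fin (m + 1) → MvPowerSeries (Fin (m + 1)) ℂ :=
    Fin.cons (L ^ (k + 1) + C ((k + 1) * a 0) * (X 0 * L ^ k))
      fun i => C ((k + 1) * a i.succ) * (X 0 * L ^ k)
  have hc : ∀ i, c i ≠ 0 := Fin.cases hk1 fun _ => hk2
  have hd : ∀ i, ((pderiv i (sectionForm k a) : MvPolynomial (Fin (m + 1)) ℂ) :
      MvPowerSeries (Fin (m + 1)) ℂ) = C (c i) * (X i ^ p i + C (c i)⁻¹ * r i) := by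
    intro i
    rw [mul_add, ← mul_assoc, ← map_mul, mul_inv_cancel₀ (hc i), map_one, one_mul]
    refine Fin.cases ?_ (fun i => ?_) i
    · rw [pderiv_sectionForm_zero]
      simp only [c, p, r, Fin.cons_zero, MvPolynomial.coe_add, MvPolynomial.coe_mul,
        MvPolynomial.coe_C, MvPolynomial.coe_pow, MvPolynomial.coe_X, hL]
    · rw [pderiv_sectionForm_succ]
      simp only [c, p, r, Fin.cons_succ, MvPolynomial.coe_add, MvPolynomial.coe_mul,
        MvPolynomial.coe_C, MvPolynomial.coe_pow, MvPolynomial.coe_X, hL]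
  have hw : ∀ i, k + 1 ≤ w i := Fin.cases (by simp [w]) (by simp [w])
  have hwL : IsOfWeightGE w (k + 1) L := isOfWeightGE_linearForm a hw
  have hX0L : IsOfWeightGE w ((k + 2) + k * (k + 1)) (X 0 * L ^ k) :=
    (isOfWeightGE_X 0).mul (hwL.pow k)
  have hr : ∀ i, IsOfWeightGE w (p i * w i + 1) (r i) := by
    refine Fin.cases ?_ fun i => ?_
    · simp only [p, w, r, Fin.cons_zero]
      exact ((hwL.pow (k + 1)).mono (by ring_nf; omega)).add
        ((hX0L.mono (by ring_nf; omega)).C_mul _)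
    · simp only [p, w, r, Fin.cons_succ]
      exact (hX0L.mono (by ring_nf; omega)).C_mul _
  have hJ : jacobianIdeal (sectionForm k a) =
      Ideal.span (Set.range fun i => X i ^ p i + C (c i)⁻¹ * r i) := by
    rw [jacobianIdeal, funext hd, span_range_C_mul c hc]
  rw [milnorNumber, hJ, toENat_rank_quotient_span_of_hasLeadingMonomial w
    (fun i => (Nat.succ_pos k |>.trans_le (hw i)).ne') p (Fin.cases hk (by simp [p]))]
  · simp [p, Fin.prod_univ_succ]
  · intro i
    rw [X_pow_eq]
    refine (HasLeadingMonomial.monomial w _).add_of_isOfWeightGE ?_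
    rw [weight_single]
    exact (hr i).C_mul _

theorem restrictToPlane_localForm (k : ℕ) (M : Matrix (Fin (m + 2)) (Fin (m + 1)) ℂ)
    (hM : M.submatrix (Fin.succAbove 1) id = 1) :
    restrictToPlane (localForm m k) M = sectionForm k (M 1) := by
  have hrow : ∀ i : Fin (m + 1), ∑ b, MvPolynomial.C (M (Fin.succAbove 1 i) b) *
      (MvPolynomial.X b : MvPolynomial (Fin (m + 1)) ℂ) = MvPolynomial.X i := by
    intro i
    have : ∀ b, M (Fin.succAbove 1 i) b = if i = b then 1 else 0 := fun b => by
      rw [← Matrix.one_apply, ← hM]; rfl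
    simp [this]
  have h0 := hrow 0
  have hs : ∀ i : Fin m, ∑ b, MvPolynomial.C (M i.succ.succ b) *
      (MvPolynomial.X b : MvPolynomial (Fin (m + 1)) ℂ) = MvPolynomial.X i.succ :=
    fun i => hrow i.succ
  change ∑ b, MvPolynomial.C (M 0 b) * _ = _ at h0
  simp only [restrictToPlane, localForm, map_add, map_mul, map_pow, map_sum,
    MvPolynomial.aeval_X, h0, hs, sectionForm, linearForm]

theorem hasSectionalMilnorNumber_localForm (hk : k ≠ 0) :
    HasSectionalMilnorNumber (localForm m k) (m + 1) (k * (k + 1) ^ m) := by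
  -- The genericity condition is the minor omitting row `1`: it is nonzero exactly when the plane is
  -- a graph over the coordinates other than `x₁`.
  let D : Matrix (Fin (m + 1)) (Fin (m + 1)) (MvPolynomial (Fin (m + 2) × Fin (m + 1)) ℂ) :=
    Matrix.of fun i j => MvPolynomial.X (Fin.succAbove 1 i, j)
  have hD : ∀ A : Matrix (Fin (m + 2)) (Fin (m + 1)) ℂ,
      MvPolynomial.eval (fun ab => A ab.1 ab.2) D.det =
        (A.submatrix (Fin.succAbove 1) id).det := by
    intro A
    rw [RingHom.map_det]
    congr 1
    ext i j
    simp [D]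
  refine ⟨D.det, fun h => ?_, fun A hA => ?_⟩
  -- The coordinate hyperplane `x₁ = 0` shows that this minor is not identically zero.
  · have := hD ((1 : Matrix (Fin (m + 2)) (Fin (m + 2)) ℂ).submatrix id (Fin.succAbove 1))
    rw [h, map_zero, Matrix.submatrix_submatrix, Function.id_comp, Function.comp_id,
      Matrix.submatrix_one _ Fin.succAbove_right_injective, Matrix.det_one] at this
    exact zero_ne_one this
  · rw [hD] at hA
    set S := A.submatrix (Fin.succAbove 1) id with hS
    have hunit : IsUnit S.det := isUnit_iff_ne_zero.2 hA
    constructor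
    · refine le_antisymm (by simpa using A.rank_le_width) ?_
      have h1 := Matrix.rank_submatrix_le A (Fin.succAbove 1) id
      rw [← hS, Matrix.rank_of_isUnit S ((Matrix.isUnit_iff_isUnit_det S).2 hunit)] at h1
      simpa using h1
    -- Reparametrizing by `S⁻¹` puts the plane in graph form.
    · rw [← milnorNumber_restrictToPlane_of_mul_eq_one (restrictToPlane (localForm m k) A)
        (Matrix.nonsing_inv_mul S hunit), restrictToPlane_restrictToPlane,
        restrictToPlane_localForm, milnorNumber_sectionForm hk]
      rw [Matrix.submatrix_mul _ _ _ id _ Function.bijective_id, ← hS, Matrix.submatrix_id_id,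
        Matrix.mul_nonsing_inv S hunit]

end SectionForm

end ProjHypersurface

end

namespace ProjHypersurface

/-! ### The projective hypersurface: gradient, singular point, local chart -/

section Example

open MvPolynomial (pderiv)

variable {m k : ℕ}

theorem zero_ne_two_fin : (0 : Fin (m + 3)) ≠ 2 := (Fin.succ_ne_zero (1 : Fin (m + 2))).symm

theorem one_ne_two_fin : (1 : Fin (m + 3)) ≠ 2 := fun h =>
  zero_ne_one (Fin.succ_injective _ (a₁ := (0 : Fin (m + 2))) (a₂ := 1) h)

theorem one_ne_succ_succ_fin (i : Fin (m + 1)) : (1 : Fin (m + 3)) ≠ i.succ.succ := fun h =>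
  Fin.succ_ne_zero i (Fin.succ_injective _ (a₁ := (0 : Fin (m + 2))) h).symm

theorem two_ne_succ_succ_succ_fin (i : Fin m) : (2 : Fin (m + 3)) ≠ i.succ.succ.succ := fun h =>
  Fin.succ_ne_zero i (Fin.succ_injective _ (Fin.succ_injective _
    (a₁ := (Fin.succ 0 : Fin (m + 2))) h)).symm

theorem exampleForm_eq (hn : 2 ≤ m + 2) :
    exampleForm (m + 2) (k + 2) hn = MvPolynomial.X 0 * MvPolynomial.X 1 ^ (k + 1) +
      MvPolynomial.X 1 * MvPolynomial.X 2 ^ (k + 1) +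
      ∑ i : Fin m, MvPolynomial.X i.succ.succ.succ ^ (k + 2) := by
  rw [exampleForm, Finset.sum_filter, Fin.sum_univ_succ, Fin.sum_univ_succ, Fin.sum_univ_succ]
  rw [if_neg (by simp), if_neg (by simp),
    if_neg (by simp only [Fin.val_succ]; simp), zero_add, zero_add, zero_add,
    Finset.sum_congr rfl fun i _ => if_pos (by simp only [Fin.val_succ]; omega)]
  rfl

variable {hn : 2 ≤ m + 2}

theorem eval_exampleForm (v : Fin (m + 3) → ℂ) :
    MvPolynomial.eval v (exampleForm (m + 2) (k + 2) hn) =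
      v 0 * v 1 ^ (k + 1) + v 1 * v 2 ^ (k + 1) + ∑ i : Fin m, v i.succ.succ.succ ^ (k + 2) := by
  simp [exampleForm_eq]

theorem exampleForm_ne_zero : exampleForm (m + 2) (k + 2) hn ≠ 0 := by
  intro h
  -- At `(1, 1, 0, …, 0)` only `z₀z₁^(k+1) = 1` survives.
  have := eval_exampleForm (k := k) (hn := hn) (Pi.single 0 1 + Pi.single 1 1)
  rw [h, map_zero] at this
  simp [zero_ne_two_fin.symm, one_ne_two_fin.symm, (one_ne_succ_succ_fin _).symm] at this

theorem isHomogeneous_exampleForm : (exampleForm (m + 2) (k + 2) hn).IsHomogeneous (k + 2) := by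
  rw [exampleForm_eq]
  have h1 : ∀ i j : Fin (m + 3), (MvPolynomial.X i * MvPolynomial.X j ^ (k + 1) :
      MvPolynomial (Fin (m + 3)) ℂ).IsHomogeneous (k + 2) := fun i j => by
    have := (MvPolynomial.isHomogeneous_X ℂ i).mul
      ((MvPolynomial.isHomogeneous_X ℂ j).pow (k + 1))
    rwa [show 1 + 1 * (k + 1) = k + 2 by ring] at this
  refine ((h1 _ _).add (h1 _ _)).add (MvPolynomial.IsHomogeneous.sum _ _ _ fun i _ => ?_)
  have := (MvPolynomial.isHomogeneous_X ℂ i.succ.succ.succ).pow (k + 2)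
  rwa [one_mul] at this

theorem gradient_exampleForm (v : Fin (m + 3) → ℂ) :
    gradient (exampleForm (m + 2) (k + 2) hn) v =
      Fin.cons (v 1 ^ (k + 1)) (Fin.cons ((k + 1) * (v 0 * v 1 ^ k) + v 2 ^ (k + 1))
        (Fin.cons ((k + 1) * (v 1 * v 2 ^ k))
          fun i : Fin m => (k + 2) * v i.succ.succ.succ ^ (k + 1))) := by
  have h0 : ∀ i : Fin m, (0 : Fin (m + 3)) ≠ i.succ.succ.succ :=
    fun i => (Fin.succ_ne_zero _).symm
  have h1 : ∀ i : Fin m, (1 : Fin (m + 3)) ≠ i.succ.succ.succ :=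
    fun i => one_ne_succ_succ_fin _
  have h2 := two_ne_succ_succ_succ_fin (m := m)
  have h12 := one_ne_two_fin (m := m)
  have h02 := zero_ne_two_fin (m := m)
  have h01 : (0 : Fin (m + 3)) ≠ 1 := zero_ne_one
  have hX : ∀ i j : Fin (m + 3), j ≠ i →
      pderiv i (MvPolynomial.X j : MvPolynomial (Fin (m + 3)) ℂ) = 0 :=
    fun i j hj => MvPolynomial.pderiv_X_of_ne hj
  have hs1 : (Fin.succ 0 : Fin (m + 3)) = 1 := rfl
  funext i
  rw [gradient, exampleForm_eq]
  simp only [map_add, map_sum, MvPolynomial.pderiv_mul]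
  simp only [pderiv_X_pow_succ]
  refine Fin.cases ?_ (fun i => Fin.cases ?_ (fun i => Fin.cases ?_ (fun i => ?_) i) i) i
  · simp [h0, h01, h02, hX 0 1 h01.symm]
  · simp [hs1, h1, h12, hX 1 0 h01]
    ring
  · change _ = (k + 1) * (v 1 * v 2 ^ k)
    simp [h2, h12.symm, hX 2 0 h02, hX 2 1 h12]
    ring
  · simp only [Fin.cons_succ, (h1 i).symm, (h2 i).symm, hX _ 0 (h0 i), hX _ 1 (h1 i),
      Fin.succ_inj, apply_ite (MvPolynomial.eval v), map_zero, add_zero, Finset.sum_ite_eq,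
      Finset.mem_univ, if_true, if_false, zero_mul, mul_zero,
      zero_add, map_mul, map_pow, MvPolynomial.eval_C, MvPolynomial.eval_X]
    push_cast
    ring

theorem gradient_exampleForm_smul (c : ℂ) (v : Fin (m + 3) → ℂ) :
    gradient (exampleForm (m + 2) (k + 2) hn) (c • v) =
      c ^ (k + 1) • gradient (exampleForm (m + 2) (k + 2) hn) v := by
  rw [gradient_exampleForm, gradient_exampleForm]
  funext i
  refine Fin.cases ?_ (fun i => Fin.cases ?_ (fun i => Fin.cases ?_ (fun i => ?_) i) i) i <;>
    simp only [Fin.cons_zero, Fin.cons_succ, Pi.smul_apply, smul_eq_mul] <;> ring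

/-- The coordinate point `(0 : ⋯ : 1 : ⋯ : 0)`. -/
noncomputable def coordinatePoint (i : Fin (m + 3)) : PSpace (m + 2) :=
  Projectivization.mk ℂ (Pi.single i 1) (by simp)

theorem eq_coordinatePoint_iff (p : PSpace (m + 2)) (i : Fin (m + 3)) :
    p = coordinatePoint i ↔ ∀ j, j ≠ i → p.rep j = 0 := by
  constructor
  · rintro rfl j hj
    obtain ⟨a, ha⟩ := Projectivization.exists_smul_eq_mk_rep ℂ
      (Pi.single i (1 : ℂ) : Fin (m + 3) → ℂ) (by simp)
    rw [coordinatePoint, ← ha]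
    simp [hj]
  · intro h
    rw [coordinatePoint, ← p.mk_rep, Projectivization.mk_eq_mk_iff']
    refine ⟨p.rep i, ?_⟩
    funext j
    by_cases hj : j = i
    · subst hj; simp
    · simp [hj, h j hj]

theorem coordinatePoint_rep_ne_zero (i : Fin (m + 3)) : (coordinatePoint i).rep i ≠ 0 := by
  intro h
  refine (coordinatePoint i).rep_nonzero ?_
  funext j
  by_cases hj : j = i
  · rw [hj, h]; rfl
  · exact (eq_coordinatePoint_iff _ i).1 rfl j hj

theorem isSingularPoint_exampleForm_iff (hk : k ≠ 0) (p : PSpace (m + 2)) :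
    IsSingularPoint (exampleForm (m + 2) (k + 2) hn) p ↔ p = coordinatePoint 0 := by
  have hk2 : (k + 2 : ℂ) ≠ 0 := by exact_mod_cast Nat.succ_ne_zero (k + 1)
  rw [eq_coordinatePoint_iff, IsSingularPoint, MemV, eval_exampleForm, gradient_exampleForm]
  constructor
  · rintro ⟨-, h⟩
    have h1 : p.rep 1 = 0 := eq_zero_of_pow_eq_zero (congrFun h 0)
    have h2 : p.rep 2 = 0 := by
      have := congrFun h 1
      change (k + 1) * (p.rep 0 * p.rep 1 ^ k) + p.rep 2 ^ (k + 1) = (0 : ℂ) at this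
      rw [h1, zero_pow hk, mul_zero, mul_zero, zero_add] at this
      exact eq_zero_of_pow_eq_zero this
    have h3 : ∀ i : Fin m, p.rep i.succ.succ.succ = 0 := fun i => by
      have := congrFun h i.succ.succ.succ
      simp only [Fin.cons_succ, Pi.zero_apply, mul_eq_zero, hk2, false_or] at this
      exact eq_zero_of_pow_eq_zero this
    intro j
    refine Fin.cases (fun h => absurd rfl h) (fun i _ => Fin.cases h1 (fun i => Fin.cases h2 h3 i) i) j
  · intro h
    have h1 : p.rep 1 = 0 := h _ one_ne_zero
    have h2 : p.rep 2 = 0 := h _ zero_ne_two_fin.symm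
    have h3 : ∀ i : Fin m, p.rep i.succ.succ.succ = 0 := fun i => h _ (Fin.succ_ne_zero _)
    refine ⟨by simp [h1, h2, h3], ?_⟩
    funext i
    rw [h1, h2]
    refine Fin.cases ?_ (fun i => Fin.cases ?_ (fun i => Fin.cases ?_ (fun i => ?_) i) i) i <;>
      simp only [Fin.cons_zero, Fin.cons_succ] <;> simp [h3, hk]

/-- The point `(0:1:0:⋯:0)` lies on the hypersurface, but on the line joining it to the apex the
form restricts to `z₀z₁^(k+1)`, which is not identically zero. -/
theorem not_isConeWithApex_exampleForm :
    ¬ IsConeWithApex (exampleForm (m + 2) (k + 2) hn) (coordinatePoint 0) := by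
  rintro ⟨-, h⟩
  have h0 := (eq_coordinatePoint_iff (m := m) _ 0).1 rfl
  have h1 := (eq_coordinatePoint_iff (m := m) _ 1).1 rfl
  have h12 := (one_ne_two_fin (m := m)).symm
  have h02 := (zero_ne_two_fin (m := m)).symm
  have h13 : ∀ i : Fin m, i.succ.succ.succ ≠ (1 : Fin (m + 3)) :=
    fun i => (one_ne_succ_succ_fin _).symm
  have := h (coordinatePoint 1) (by
    rw [MemV, eval_exampleForm]
    simp [h1 0 (by simp), h1 2 h12, h1 _ (h13 _)]) 1 1
  rw [eval_exampleForm] at this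
  simp [h1 0 (by simp), h1 2 h12, h1 _ (h13 _), h0 1 (by simp), h0 2 h02,
    h0 _ (Fin.succ_ne_zero _), coordinatePoint_rep_ne_zero] at this

theorem localEquation_exampleForm :
    localEquation (exampleForm (m + 2) (k + 2) hn) (coordinatePoint 0) 0 = localForm m k := by
  have h0 := (eq_coordinatePoint_iff (m := m) _ 0).1 rfl
  have hsub : (fun a : Fin (m + 2) => (MvPolynomial.X a : MvPolynomial (Fin (m + 2)) ℂ) +
      MvPolynomial.C ((coordinatePoint (m := m) 0).rep ((0 : Fin (m + 3)).succAbove a) /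
        (coordinatePoint (m := m) 0).rep 0)) = MvPolynomial.X := by
    funext a
    rw [h0 _ (Fin.succAbove_ne 0 a), zero_div, map_zero, add_zero]
  rw [localEquation, hsub, Fin.insertNth_zero', exampleForm_eq, localForm]
  have hs1 : (1 : Fin (m + 3)) = Fin.succ 0 := rfl
  have hs2 : (2 : Fin (m + 3)) = Fin.succ 1 := rfl
  simp only [hs1, hs2, map_add, map_mul, map_pow, map_sum, MvPolynomial.aeval_X, Fin.cons_zero,
    Fin.cons_succ, one_mul]

/-! ### Fibres of the gradient map and the polar degree -/

theorem mk_mem_gradientFibre_exampleForm_iff (q : PSpace (m + 2)) {v : Fin (m + 3) → ℂ}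
    (hv : v ≠ 0) :
    Projectivization.mk ℂ v hv ∈ gradientFibre (exampleForm (m + 2) (k + 2) hn) q ↔
      ∃ a : ℂ, a ≠ 0 ∧ gradient (exampleForm (m + 2) (k + 2) hn) v = a • q.rep := by
  obtain ⟨c, hc⟩ := Projectivization.exists_smul_eq_mk_rep ℂ v hv
  -- The gradient is homogeneous of degree `k + 1`, so passing to the chosen representative only
  -- rescales it.
  have hg : gradient (exampleForm (m + 2) (k + 2) hn) (Projectivization.mk ℂ v hv).rep =
      (c : ℂ) ^ (k + 1) • gradient (exampleForm (m + 2) (k + 2) hn) v := by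
    rw [← hc, ← gradient_exampleForm_smul]; rfl
  have hc0 : (c : ℂ) ^ (k + 1) ≠ 0 := pow_ne_zero _ c.ne_zero
  constructor
  · rintro ⟨hp, h⟩
    rw [← q.mk_rep, Projectivization.mk_eq_mk_iff'] at h
    obtain ⟨a, ha⟩ := h
    rw [hg] at ha hp
    refine ⟨((c : ℂ) ^ (k + 1))⁻¹ * a, mul_ne_zero (inv_ne_zero hc0) ?_, ?_⟩
    · rintro rfl
      rw [zero_smul] at ha
      exact hp ha.symm
    · rw [mul_smul, ha, inv_smul_smul₀ hc0]
  · rintro ⟨a, ha, h⟩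
    rw [h, smul_smul] at hg
    have hp : gradient (exampleForm (m + 2) (k + 2) hn) (Projectivization.mk ℂ v hv).rep ≠ 0 := by
      rw [hg]
      exact smul_ne_zero (mul_ne_zero hc0 ha) q.rep_nonzero
    refine ⟨hp, ?_⟩
    conv_rhs => rw [← q.mk_rep]
    rw [Projectivization.mk_eq_mk_iff']
    exact ⟨_, hg.symm⟩

theorem card_nthRootsFinset_of_ne_zero {n : ℕ} (hn : n ≠ 0) {a : ℂ} (ha : a ≠ 0) :
    (Polynomial.nthRootsFinset n a).card = n := by
  have hζ := Complex.isPrimitiveRoot_exp n hn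
  rw [Polynomial.nthRootsFinset_def, Multiset.toFinset_card_of_nodup (hζ.nthRoots_nodup ha),
    hζ.card_nthRoots, if_pos]
  exact IsAlgClosed.exists_pow_nat_eq a (Nat.pos_of_ne_zero hn)

/-- The representatives with `z₁ = 1` of the points in the fibre of the gradient map. -/
noncomputable def fibreVector (k : ℕ) (b : ℂ) (c : Fin (m + 1) → ℂ) : Fin (m + 3) → ℂ :=
  Fin.cons ((b - c 0 ^ (k + 1)) / (k + 1)) (Fin.cons 1 c)

theorem fibreVector_ne_zero (b : ℂ) (c : Fin (m + 1) → ℂ) : fibreVector k b c ≠ 0 := by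
  intro h
  have h1 : (1 : ℂ) = 0 := congrFun h 1
  exact one_ne_zero h1

theorem encard_gradientFibre_exampleForm (hk : k ≠ 0) (q : PSpace (m + 2))
    (hq : ∀ i, q.rep i ≠ 0) :
    (gradientFibre (exampleForm (m + 2) (k + 2) hn) q).encard = (k * (k + 1) ^ m : ℕ) := by
  have hk1 : (k + 1 : ℂ) ≠ 0 := by exact_mod_cast Nat.succ_ne_zero k
  have hk2 : (k + 2 : ℂ) ≠ 0 := by exact_mod_cast Nat.succ_ne_zero (k + 1)
  set Q := q.rep with hQ
  -- With `z₁ = 1`, dividing the fibre equations by the first one leaves independent root equations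
  -- for `z₂` and the later coordinates.
  let R : Fin (m + 1) → Finset ℂ := Fin.cons
    (Polynomial.nthRootsFinset k (Q 2 / (Q 0 * (k + 1))))
    fun i => Polynomial.nthRootsFinset (k + 1) (Q i.succ.succ.succ / (Q 0 * (k + 2)))
  have hR : (Fintype.piFinset R).card = k * (k + 1) ^ m := by
    rw [Fintype.card_piFinset, Fin.prod_univ_succ]
    simp only [R, Fin.cons_zero, Fin.cons_succ]
    rw [card_nthRootsFinset_of_ne_zero hk (div_ne_zero (hq _) (mul_ne_zero (hq _) hk1)),
      Finset.prod_congr rfl fun i _ => card_nthRootsFinset_of_ne_zero (Nat.succ_ne_zero k)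
        (div_ne_zero (hq _) (mul_ne_zero (hq _) hk2))]
    simp
  have hmem : ∀ c, c ∈ Fintype.piFinset R ↔ (k + 1) * c 0 ^ k = Q 2 / Q 0 ∧
      ∀ i : Fin m, (k + 2) * c i.succ ^ (k + 1) = Q i.succ.succ.succ / Q 0 := by
    intro c
    rw [Fintype.mem_piFinset, Fin.forall_fin_succ]
    simp only [R, Fin.cons_zero, Fin.cons_succ,
      Polynomial.mem_nthRootsFinset (Nat.pos_of_ne_zero hk),
      Polynomial.mem_nthRootsFinset (Nat.succ_pos k)]
    have h0 := hq 0
    refine and_congr ?_ (forall_congr' fun i => ?_)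
    · constructor <;> intro h <;> field_simp at h ⊢ <;> linear_combination h
    · constructor <;> intro h <;> field_simp at h ⊢ <;> linear_combination h
  let Φ : (Fin (m + 1) → ℂ) → PSpace (m + 2) := fun c =>
    Projectivization.mk ℂ (fibreVector k (Q 1 / Q 0) c) (fibreVector_ne_zero _ _)
  have hinj : Function.Injective Φ := by
    intro c c' h
    obtain ⟨a, ha⟩ := (Projectivization.mk_eq_mk_iff' ..).1 h
    have h1 : a * 1 = 1 := congrFun ha 1
    rw [mul_one] at h1
    rw [h1, one_smul] at ha
    funext i
    exact (congrFun ha i.succ.succ).symm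
  have himage : gradientFibre (exampleForm (m + 2) (k + 2) hn) q =
      Φ '' (Fintype.piFinset R : Finset (Fin (m + 1) → ℂ)) := by
    ext p
    constructor
    · intro hp
      rw [← p.mk_rep, mk_mem_gradientFibre_exampleForm_iff] at hp
      obtain ⟨a, ha, hg⟩ := hp
      set v := p.rep with hv
      -- The first gradient coordinate is `z₁^(k+1)`, so `Q 0 ≠ 0` excludes `z₁ = 0`.
      have hv1 : v 1 ≠ 0 := by
        intro h
        have := congrFun hg 0
        rw [gradient_exampleForm] at this
        simp only [Fin.cons_zero, h, Pi.smul_apply, smul_eq_mul, zero_pow (Nat.succ_ne_zero k)]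
          at this
        exact mul_ne_zero ha (hq 0) this.symm
      obtain ⟨z, hz⟩ : ∃ z, z = (v 1)⁻¹ • v := ⟨_, rfl⟩
      have hz1 : z 1 = 1 := by simp [hz, hv1]
      have hgz : gradient (exampleForm (m + 2) (k + 2) hn) z =
          ((v 1)⁻¹ ^ (k + 1) * a) • Q := by
        rw [hz, gradient_exampleForm_smul, hg, smul_smul]
      -- After normalization the first gradient coordinate is `1`, which fixes the proportionality
      -- factor.
      have hb : ((v 1)⁻¹ ^ (k + 1) * a) = (Q 0)⁻¹ := by
        have := congrFun hgz 0
        rw [gradient_exampleForm] at this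
        simp only [Fin.cons_zero, hz1, one_pow, Pi.smul_apply, smul_eq_mul] at this
        exact eq_inv_of_mul_eq_one_left this.symm
      rw [hb, gradient_exampleForm] at hgz
      have e1 : (k + 1) * (z 0 * z 1 ^ k) + z 2 ^ (k + 1) = (Q 0)⁻¹ * Q 1 := congrFun hgz 1
      have e2 : (k + 1) * (z 1 * z 2 ^ k) = (Q 0)⁻¹ * Q 2 := congrFun hgz 2
      have e3 : ∀ i : Fin m, (k + 2) * z i.succ.succ.succ ^ (k + 1) =
          (Q 0)⁻¹ * Q i.succ.succ.succ := fun i => congrFun hgz i.succ.succ.succ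
      rw [hz1, one_pow, mul_one] at e1
      rw [hz1, one_mul] at e2
      refine ⟨fun i => z i.succ.succ, ?_, ?_⟩
      · rw [Finset.mem_coe, hmem]
        refine ⟨?_, fun i => ?_⟩
        · rw [div_eq_inv_mul, ← e2]; rfl
        · rw [div_eq_inv_mul, ← e3]
      · have hzz : fibreVector k (Q 1 / Q 0) (fun i => z i.succ.succ) = z := by
          funext i
          refine Fin.cases ?_ (fun i => Fin.cases ?_ (fun i => ?_) i) i
          · change (Q 1 / Q 0 - z 2 ^ (k + 1)) / (k + 1) = z 0
            rw [div_eq_inv_mul (Q 1), ← e1]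
            field_simp
            ring
          · exact hz1.symm
          · rfl
        conv_rhs => rw [← p.mk_rep]
        rw [Projectivization.mk_eq_mk_iff']
        exact ⟨(v 1)⁻¹, by rw [hzz, hz]⟩
    · rintro ⟨c, hc, rfl⟩
      rw [Finset.mem_coe, hmem] at hc
      rw [mk_mem_gradientFibre_exampleForm_iff]
      refine ⟨(Q 0)⁻¹, inv_ne_zero (hq 0), ?_⟩
      rw [gradient_exampleForm]
      funext i
      refine Fin.cases ?_ (fun i => Fin.cases ?_ (fun i => Fin.cases ?_ (fun i => ?_) i) i) i
      · change (1 : ℂ) ^ (k + 1) = (Q 0)⁻¹ * Q 0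
        rw [one_pow, inv_mul_cancel₀ (hq 0)]
      · change (k + 1) * ((Q 1 / Q 0 - c 0 ^ (k + 1)) / (k + 1) * 1 ^ k) + c 0 ^ (k + 1) =
          (Q 0)⁻¹ * Q 1
        rw [one_pow, mul_one, mul_div_cancel₀ _ hk1, div_eq_inv_mul]
        ring
      · change (k + 1) * (1 * c 0 ^ k) = (Q 0)⁻¹ * Q 2
        rw [one_mul, hc.1, div_eq_inv_mul]
      · change (k + 2) * c i.succ ^ (k + 1) = (Q 0)⁻¹ * Q i.succ.succ.succ
        rw [hc.2, div_eq_inv_mul]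
  rw [himage, hinj.encard_image, Set.encard_coe_eq_coe_finsetCard, hR]

theorem hasPolarDegree_exampleForm (hk : k ≠ 0) :
    HasPolarDegree (exampleForm (m + 2) (k + 2) hn) (k * (k + 1) ^ m) := by
  -- Generic here means lying off all the coordinate hyperplanes.
  refine ⟨∏ i, MvPolynomial.X i, ∑ _i : Fin (m + 3), 1,
    Finset.prod_ne_zero_iff.2 fun i _ => MvPolynomial.X_ne_zero i,
    MvPolynomial.IsHomogeneous.prod _ _ _ fun i _ => MvPolynomial.isHomogeneous_X ℂ i,
    fun q hq => encard_gradientFibre_exampleForm hk q fun i hi => hq ?_⟩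
  rw [MemV, map_prod]
  exact Finset.prod_eq_zero (Finset.mem_univ i) (by rw [MvPolynomial.eval_X, hi])

end Example

end ProjHypersurface

theorem proposition17 (n d : ℕ) (hn : 2 ≤ n) (hd : 3 ≤ d) :
    (ProjHypersurface.exampleForm n d hn ≠ 0 ∧
      (ProjHypersurface.exampleForm n d hn).IsHomogeneous d) ∧
    ∃ x : ProjHypersurface.PSpace n,
      (∀ p : ProjHypersurface.PSpace n,
        ProjHypersurface.IsSingularPoint (ProjHypersurface.exampleForm n d hn) p ↔ p = x) ∧
      ¬ ProjHypersurface.IsConeWithApex (ProjHypersurface.exampleForm n d hn) x ∧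
      ∃ μ ν : ℕ,
        ProjHypersurface.HasMilnorNumberAt (ProjHypersurface.exampleForm n d hn) x μ ∧
        (μ : ℤ) = ((d : ℤ) - 1) ^ n - ((d : ℤ) - 1) ^ (n - 1) + ((d : ℤ) - 1) ^ (n - 2) ∧
        ProjHypersurface.HasSectionalMilnorNumberAt (ProjHypersurface.exampleForm n d hn) x
          (n - 1) ν ∧
        (ν : ℤ) = ((d : ℤ) - 1) ^ (n - 1) - ((d : ℤ) - 1) ^ (n - 2) ∧
        ProjHypersurface.HasPolarDegree (ProjHypersurface.exampleForm n d hn) ν := by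
  obtain ⟨m, rfl⟩ := Nat.exists_eq_add_of_le' hn
  obtain ⟨k, rfl⟩ := Nat.exists_eq_add_of_le' (show 2 ≤ d by omega)
  have hk : k ≠ 0 := by omega
  -- Only the chart `z₀ ≠ 0` contains the singular point, so a single local equation has to be
  -- examined.
  have hchart : ∀ j, (ProjHypersurface.coordinatePoint (m := m) 0).rep j ≠ 0 → j = 0 :=
    fun j hj => by
      by_contra h
      exact hj ((ProjHypersurface.eq_coordinatePoint_iff _ 0).1 rfl j h)
  have hd1 : ((k + 2 : ℕ) : ℤ) - 1 = k + 1 := by push_cast; ring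
  refine ⟨⟨ProjHypersurface.exampleForm_ne_zero, ProjHypersurface.isHomogeneous_exampleForm⟩,
    ProjHypersurface.coordinatePoint 0, ProjHypersurface.isSingularPoint_exampleForm_iff hk,
    ProjHypersurface.not_isConeWithApex_exampleForm,
    (k ^ 2 + k + 1) * (k + 1) ^ m, k * (k + 1) ^ m, fun j hj => ?_, ?_, fun j hj => ?_, ?_,
    ProjHypersurface.hasPolarDegree_exampleForm hk⟩
  · rw [hchart j hj, ProjHypersurface.localEquation_exampleForm]
    exact ProjHypersurface.milnorNumber_localForm hk
  · rw [hd1, show m + 2 - 1 = m + 1 from rfl, show m + 2 - 2 = m from rfl]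
    push_cast
    ring
  · rw [hchart j hj, ProjHypersurface.localEquation_exampleForm]
    exact ProjHypersurface.hasSectionalMilnorNumber_localForm hk
  · rw [hd1, show m + 2 - 1 = m + 1 from rfl, show m + 2 - 2 = m from rfl]
    push_cast
    ring
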